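/- Let $n\ge 1$ be odd, let $D_n=\langle x,y\mid x^n=y^2=1,\ yx=x^{-1}y\rangle$ be the dihedral group of order $2n$, and let $H=\langle y\rangle$. Let $E_HD_n=(D_n/H)^{*\infty}$ be the infinite join of copies of the finite discrete $D_n$-set $D_n/H$, with the colimit topology of the finite joins and the diagonal action of $D_n$. Let $\mathcal{M}$ be a coefficient system for $D_n$, that is, a contravariant functor from the orbit category of $D_n$ (objects the orbits $D_n/K$, morphisms the equivariant maps) to abelian groups. Let $\mathcal{M}^e$ be the $D_n$-module $\mathcal{M}(D_n/e)$, on which $g\in D_n$ acts by $\mathcal{M}$ applied to the right translation by $g$. The Bredon cohomology $H^*_{D_n}(X;\mathcal{M})$ of a $D_n$-space $X$ is the cohomology of the cochain complex $\mathrm{Hom}(\underline{C}_*(X),\mathcal{M})$ of homomorphisms of coefficient systems, where $\underline{C}_*(X)(D_n/K)=C_*(X^K;\mathbb{Z})$ is the singular chain complex of the fixed point space. (1) There are homomorphisms $H^i_{D_n}(E_HD_n;\mathcal{M})\to H^i(D_n;\mathcal{M}^e)$ for $i\ge 2$ and $H^i(H;\mathcal{M}^e)\to H^{i+1}_{D_n}(E_HD_n;\mathcal{M})$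 for $i\ge 1$, an abelian group $A$, and homomorphisms $H^0(H;\mathcal{M}^e)\to A$ and $A\to H^1(D_n;\mathcal{M}^e)$ such that the sequence $$0\to H^0(D_n;\mathcal{M}^e)\to H^0(H;\mathcal{M}^e)\to A\to H^1(D_n;\mathcal{M}^e)\to H^1(H;\mathcal{M}^e)\to H^2_{D_n}(E_HD_n;\mathcal{M})\to\cdots$$ $$\cdots\to H^i_{D_n}(E_HD_n;\mathcal{M})\to H^i(D_n;\mathcal{M}^e)\to H^i(H;\mathcal{M}^e)\to H^{i+1}_{D_n}(E_HD_n;\mathcal{M})\to\cdots\qquad(i\ge 2)$$ is exact, where the maps $H^i(D_n;\mathcal{M}^e)\to H^i(H;\mathcal{M}^e)$ are the restriction maps in group cohomology. Moreover, for the same group $A$ there is a surjective homomorphism $A\to H^1_{D_n}(E_HD_n;\mathcal{M})$. (2) Let $m$ be a positive integer relatively prime to $2n$, and suppose that $\mathcal{M}^e$ is $m$-profinite, that is, the abelian group $\mathcal{M}^e$ is the limit of an inverse system, indexed by a directed set, of abelian torsion groups in which the order of every element is a product of primes dividing $m$. Then $H^i_{D_n}(E_HD_n;\mathcal{M})=0$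 for all $i>1$. -/

import Mathlib

open CategoryTheory CategoryTheory.Limits

noncomputable section

/-! ### The orbit category and coefficient systems -/

/-- The orbit category of a group `G`. The object `⟨K⟩` stands for the orbit `G/K`; the morphisms
`G/K ⟶ G/L` are the `G`-equivariant maps. -/
structure OrbitCat (G : Type) [Group G] where
  /-- The subgroup `K` of the orbit `G/K`. -/
  sub : Subgroup G

instance (G : Type) [Group G] : Category (OrbitCat G) where
  Hom K L := (G ⧸ K.sub) →[G] (G ⧸ L.sub)
  id K := MulActionHom.id G
  comp f g := g.comp f

/-- A coefficient system: a contravariant functor from the orbit category to abelian groups. -/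
abbrev CoeffSystem (G : Type) [Group G] := (OrbitCat G)ᵒᵖ ⥤ ModuleCat.{0} ℤ

/-- Right translation `x ↦ x g`, as an endomorphism of the orbit `G/e`. -/
def rightTranslation {G : Type} [Group G] (g : G) :
    (⟨⊥⟩ : OrbitCat G) ⟶ ⟨⊥⟩ :=
  show (G ⧸ (⊥ : Subgroup G)) →[G] (G ⧸ (⊥ : Subgroup G)) from
  { toFun := Quotient.map' (fun x => x * g) (by
      intro a b h
      rw [QuotientGroup.leftRel_apply, Subgroup.mem_bot] at h ⊢
      have : a = b := inv_mul_eq_one.mp h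
      simp [this])
    map_smul' := by
      intro a x
      induction x using Quotient.inductionOn' with
      | h x =>
        change (Quotient.mk'' _ : G ⧸ (⊥ : Subgroup G)) = Quotient.mk'' _
        simp [mul_assoc] }

theorem rightTranslation_one {G : Type} [Group G] :
    rightTranslation (1 : G) = 𝟙 (⟨⊥⟩ : OrbitCat G) := by
  refine MulActionHom.ext fun x => ?_
  induction x using Quotient.inductionOn' with
  | h x =>
    change (Quotient.mk'' (x * 1) : G ⧸ (⊥ : Subgroup G)) = Quotient.mk'' x
    simp

theorem rightTranslation_mul {G : Type} [Group G] (g h : G) :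
    rightTranslation (g * h) = rightTranslation g ≫ rightTranslation h := by
  refine MulActionHom.ext fun x => ?_
  induction x using Quotient.inductionOn' with
  | h x =>
    change (Quotient.mk'' (x * (g * h)) : G ⧸ (⊥ : Subgroup G)) = Quotient.mk'' (x * g * h)
    simp [mul_assoc]

/-- The `G`-module `M^e = M(G/e)` of a coefficient system `M`: an element `g` acts by the map which
`M` assigns to the right translation by `g`. -/
def CoeffSystem.atE {G : Type} [Group G] (M : CoeffSystem G) : Rep.{0} ℤ G :=
  Rep.of (X := M.obj (Opposite.op ⟨⊥⟩))
    { toFun := fun g => (M.map (rightTranslation g).op).hom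
      map_one' := by
        rw [rightTranslation_one, op_id, M.map_id]
        rfl
      map_mul' := fun g h => by
        rw [rightTranslation_mul, op_comp, M.map_comp]
        rfl }

/-! ### Bredon cohomology -/

section Bredon

variable {G : Type} [Group G] (X : Type) [MulAction G X]

/-- For `x` in `X^L`, the `G`-map `G/L → X` which sends `gL` to `g • x`. -/
def orbitMap {L : Subgroup G} (x : MulAction.fixedPoints L X) : (G ⧸ L) → X :=
  Quotient.lift (fun g : G => g • (x : X)) (by
    intro a b h
    have h' : a⁻¹ * b ∈ L := QuotientGroup.leftRel_apply.mp h
    have h2 : (a⁻¹ * b) • (x : X) = x := x.2 ⟨_, h'⟩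
    calc a • (x : X) = a • ((a⁻¹ * b) • (x : X)) := by rw [h2]
      _ = b • (x : X) := by rw [smul_smul]; simp)

theorem orbitMap_smul {L : Subgroup G} (x : MulAction.fixedPoints L X) (g : G) (y : G ⧸ L) :
    orbitMap X x (g • y) = g • orbitMap X x y := by
  induction y using Quotient.inductionOn' with
  | h y => exact mul_smul g y (x : X)

variable [TopologicalSpace X] [ContinuousConstSMul G X]

/-- The map `X^L → X^K` induced by a `G`-map `φ : G/K → G/L`. If `φ (eK) = gL`, it sends `x` to
`g • x`. -/
def fixedPointsMap {K L : OrbitCat G} (φ : K ⟶ L) :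
    C(MulAction.fixedPoints L.sub X, MulAction.fixedPoints K.sub X) where
  toFun x := ⟨orbitMap X x (MulActionHom.toFun φ ((1 : G) : G ⧸ K.sub)), fun k => by
    have h := MulActionHom.map_smul' φ (k : G) ((1 : G) : G ⧸ K.sub)
    have hk : (k : G) • ((1 : G) : G ⧸ K.sub) = ((1 : G) : G ⧸ K.sub) := by
      rw [MulAction.Quotient.smul_coe, QuotientGroup.eq]
      simp
    rw [hk] at h
    change (k : G) • orbitMap X x _ = _
    rw [← orbitMap_smul]
    exact congrArg _ h.symm⟩
  continuous_toFun := by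
    refine Continuous.subtype_mk ?_ _
    obtain ⟨g, hg⟩ := QuotientGroup.mk_surjective (MulActionHom.toFun φ ((1 : G) : G ⧸ K.sub))
    rw [← hg]
    exact (continuous_const_smul g).comp continuous_subtype_val

/-- The functor `G/K ↦ X^K` from the opposite of the orbit category to topological spaces. -/
def fixedPointsFunctor : (OrbitCat G)ᵒᵖ ⥤ TopCat.{0} where
  obj K := TopCat.of (MulAction.fixedPoints K.unop.sub X)
  map φ := TopCat.ofHom (fixedPointsMap X φ.unop)
  map_id K := by
    ext x
    exact one_smul G (x : X)
  map_comp {K L P} φ ψ := by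
    ext x
    change orbitMap X x (MulActionHom.toFun φ.unop (MulActionHom.toFun ψ.unop _)) =
      orbitMap X (fixedPointsMap X φ.unop x) (MulActionHom.toFun ψ.unop _)
    generalize MulActionHom.toFun ψ.unop _ = y
    induction y using Quotient.inductionOn' with
    | h g =>
      have h := MulActionHom.map_smul' φ.unop g ((1 : G) : G ⧸ L.unop.sub)
      have hg : g • ((1 : G) : G ⧸ L.unop.sub) = (Quotient.mk'' g : G ⧸ L.unop.sub) := by
        rw [MulAction.Quotient.smul_coe]
        simp
      rw [hg] at h
      refine (congrArg (orbitMap X x) h).trans ?_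
      exact orbitMap_smul X x g _

/-- The integral singular chain complexes `C_*(X^K; ℤ)`, as a functor of `G/K`. -/
def singularChainsFunctor : (OrbitCat G)ᵒᵖ ⥤ ChainComplex (ModuleCat.{0} ℤ) ℕ :=
  fixedPointsFunctor X ⋙
    (AlgebraicTopology.singularChainComplexFunctor (ModuleCat.{0} ℤ)).obj (ModuleCat.of ℤ ℤ)

/-- The chain complex of coefficient systems `C_n(X)(G/K) = C_n(X^K; ℤ)`. -/
def bredonChains : ChainComplex (CoeffSystem G) ℕ where
  X n := singularChainsFunctor X ⋙ HomologicalComplex.eval _ _ n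
  d i j :=
    { app := fun K => ((singularChainsFunctor X).obj K).d i j
      naturality := fun _ _ φ => ((singularChainsFunctor X).map φ).comm i j }
  shape i j h := by
    ext K : 2
    exact ((singularChainsFunctor X).obj K).shape i j h
  d_comp_d' i j k _ _ := by
    ext K : 2
    exact ((singularChainsFunctor X).obj K).d_comp_d i j k

/-- The Bredon cohomology group `H^i_G(X; M)`: the cohomology of the cochain complex with terms
`Hom(C_n(X), M)`, the homomorphisms being those of coefficient systems. -/
def bredonCohomology (M : CoeffSystem G) (i : ℕ) : ModuleCat.{0} ℤ :=
  ((bredonChains (G := G) X).linearYonedaObj ℤ M).homology i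

end Bredon

/-! ### The infinite join of a finite discrete set -/

/-- The infinite join `S * S * S * ⋯` of a finite discrete space `S`, in barycentric coordinates:
a point is a formal convex combination `∑ tᵢ sᵢ` with `sᵢ` in the `i`-th copy of `S`, almost all `tᵢ`
being zero, and `sᵢ` is disregarded where `tᵢ = 0`. It is recorded by the weights on the points
`(i, s)` of the disjoint union of the copies. -/
@[ext]
structure InfiniteJoin (S : Type) where
  /-- The weights. -/
  weight : ℕ × S →₀ ℝ
  nonneg : ∀ v, 0 ≤ weight v
  unique : ∀ i s t, weight (i, s) ≠ 0 → weight (i, t) ≠ 0 → s = t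
  sum_eq_one : (weight.sum fun _ r => r) = 1

namespace InfiniteJoin

variable (S : Type)

/-- The join of the first `N` copies of `S`. -/
def Stage (N : ℕ) : Type := {x : InfiniteJoin S // ∀ v, N ≤ v.1 → x.weight v = 0}

/-- For `S` finite and discrete, the join of `N` copies of `S` is a finite simplicial complex with
vertices the `(i, s)`, `i < N`; its topology is induced by the barycentric coordinates. -/
instance (N : ℕ) : TopologicalSpace (Stage S N) :=
  TopologicalSpace.induced (fun x (v : ℕ × S) => x.1.weight v) inferInstance

/-- The infinite join carries the colimit topology of the finite joins. -/
instance : TopologicalSpace (InfiniteJoin S) :=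
  ⨆ N : ℕ, TopologicalSpace.coinduced (fun x : Stage S N => x.1) inferInstance

variable {S} {G : Type} [Group G] [MulAction G S]

/-- `G` acts on the copies of `S` simultaneously: `g • ∑ tᵢ sᵢ = ∑ tᵢ (g • sᵢ)`. -/
instance : SMul G (InfiniteJoin S) where
  smul g x :=
    { weight := x.weight.equivMapDomain ((Equiv.refl ℕ).prodCongr (MulAction.toPerm g))
      nonneg := fun v => x.nonneg _
      unique := fun i s t hs ht =>
        MulAction.injective g⁻¹ (x.unique i (g⁻¹ • s) (g⁻¹ • t) hs ht)
      sum_eq_one := by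
        rw [Finsupp.equivMapDomain_eq_mapDomain, Finsupp.sum_mapDomain_index (by simp) (by simp)]
        exact x.sum_eq_one }

theorem weight_smul (g : G) (x : InfiniteJoin S) (i : ℕ) (s : S) :
    (g • x).weight (i, s) = x.weight (i, g⁻¹ • s) := rfl

instance : MulAction G (InfiniteJoin S) where
  one_smul x := by
    ext ⟨i, s⟩
    simp [weight_smul]
  mul_smul g h x := by
    ext ⟨i, s⟩
    simp [weight_smul, mul_smul]

instance : ContinuousConstSMul G (InfiniteJoin S) where
  continuous_const_smul g := by
    refine continuous_iSup_dom.mpr fun N => continuous_coinduced_dom.mpr ?_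
    let f : Stage S N → Stage S N := fun x => ⟨g • x.1, fun v hv => x.2 _ hv⟩
    have hf : Continuous f := by
      refine continuous_induced_rng.mpr (continuous_pi fun v => ?_)
      exact (continuous_apply ((v.1, g⁻¹ • v.2) : ℕ × S)).comp continuous_induced_dom
    have hi : Continuous (fun x : Stage S N => x.1) :=
      continuous_iSup_rng (i := N) continuous_coinduced_rng
    exact hi.comp hf

end InfiniteJoin

/-! ### Dihedral groups and the universal space -/

/-- The subgroup `H = ⟨y⟩` of order two of the dihedral group
`D_n = ⟨x, y | xⁿ = y² = 1, yx = x⁻¹y⟩`, with `x = r 1` and `y = sr 0`. -/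
def reflectionSubgroup (n : ℕ) : Subgroup (DihedralGroup n) :=
  Subgroup.zpowers (DihedralGroup.sr 0)

/-- The space `E_H D_n`, the infinite join of copies of `D_n/H`. -/
abbrev EHD (n : ℕ) : Type := InfiniteJoin (DihedralGroup n ⧸ reflectionSubgroup n)

/-- The restriction map `H^i(G; V) → H^i(K; V)` in group cohomology. -/
def groupCohomologyRes {G : Type} [Group G] (K : Subgroup G) (V : Rep.{0} ℤ G) (i : ℕ) :
    groupCohomology V i ⟶ groupCohomology (Rep.res K.subtype V) i :=
  groupCohomology.map K.subtype (𝟙 _) i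

/-- An abelian group is `m`-profinite if it is the limit of an inverse system, indexed by a directed
set, of abelian groups in which every element has order a product of primes dividing `m`
(that is, is killed by a power of `m`). -/
def IsMProfinite (m : ℕ) (B : Type) [AddCommGroup B] : Prop :=
  ∃ (I : Type) (_ : Preorder I) (_ : IsDirectedOrder I) (_ : Nonempty I)
    (F : Iᵒᵖ ⥤ AddCommGrpCat.{0}),
    (∀ (j : Iᵒᵖ) (x : F.obj j), ∃ k : ℕ, m ^ k • x = 0) ∧
      Nonempty (AddCommGrpCat.of B ≅ limit F)

end

/-! Write G = D_n. The fixed space of a subgroup K on the infinite join of copies of G/H is empty if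
K fixes no coset of H and contractible otherwise (`InfiniteJoin.contractibleSpace_fixedPoints`). The
singular chains of any G-space are sums of representable coefficient systems, hence projective. So
the Bredon chains of the join are a projective resolution of `supportZ H` (`bredonResolution`),
Bredon cohomology is Ext out of `supportZ H`, and any other projective resolution computes it.

A second resolution comes from group cohomology (`relResolution`). At G/e, divide the bar resolution
ℤ[G] ⊗ ℤ[G^i] of ℤ by the subcomplex ℤ[G] ⊗ ℤ[H^i], which resolves ℤ[G/H]. The quotient vanishes in
degree 0, and its only homology is the kernel of ℤ[G/H] → ℤ, in degree 1; placing ℤ[Hom(-, G/H)] in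
degree 0 therefore makes the augmented complex exact. At orbits with nontrivial isotropy the
positive terms vanish, and ℤ[Hom(-, G/H)] → `supportZ H` is an isomorphism provided such an orbit
has at most one map to G/H. For n odd this holds because H is its own centralizer
(`subsingleton_hom_reflectionSubgroup`).

Morphisms from the quotient complex to M are the inhomogeneous cochains of M^e that vanish on tuples
in H, which is the kernel of restriction to H (`relCochains_shortExact`). The long exact sequence of
cohomology is the required one, with A the first relative cohomology group. Passing from the
quotient complex to the resolution changes only degree 0: cohomology in degrees at least 2 stays the
same, and degree 1 acquires further coboundaries, which gives the surjection out of A.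

For (2), multiplication by an integer prime to m is bijective on an m-profinite group, so averaging
kills the positive cohomology of G and of H, and the Bredon groups sit between two zeros. -/

open Opposite

noncomputable section

/-! ### Presheaves that are sums of representables -/

section RepBasis

variable {O : Type} [SmallCategory O] {ι : Type} {L : ι → O}

/-- A presentation of a presheaf of abelian groups as the direct sum of the linearized
representable presheaves `ℤ[Hom(-, L a)]`. -/
structure RepBasis (P : Oᵒᵖ ⥤ ModuleCat.{0} ℤ) (L : ι → O) where
  /-- The universal elements. -/
  p : ∀ a, P.obj (op (L a))
  /-- The basis of the values of the presheaf. -/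
  basis : ∀ K : O, Module.Basis (Σ a, K ⟶ L a) ℤ (P.obj (op K))
  basis_apply : ∀ (K : O) (a : ι) (φ : K ⟶ L a), basis K ⟨a, φ⟩ = P.map φ.op (p a)

namespace RepBasis

variable {P M N : Oᵒᵖ ⥤ ModuleCat.{0} ℤ} (B : RepBasis P L)

/-- The morphism of presheaves with prescribed values on the universal elements. -/
def desc (m : ∀ a, M.obj (op (L a))) : P ⟶ M where
  app K := ModuleCat.ofHom ((B.basis K.unop).constr ℕ fun x => M.map x.2.op (m x.1))
  naturality K K' ψ := by
    ext : 1
    refine (B.basis K.unop).ext fun ⟨a, φ⟩ => ?_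
    have h : P.map ψ (B.basis K.unop ⟨a, φ⟩) = B.basis K'.unop ⟨a, ψ.unop ≫ φ⟩ := by
      rw [B.basis_apply, B.basis_apply, op_comp, P.map_comp]
      rfl
    change (B.basis K'.unop).constr ℕ _ (P.map ψ (B.basis K.unop ⟨a, φ⟩)) =
      M.map ψ ((B.basis K.unop).constr ℕ _ (B.basis K.unop ⟨a, φ⟩))
    rw [h, Module.Basis.constr_basis, Module.Basis.constr_basis, op_comp, M.map_comp]
    rfl

theorem desc_app_map (m : ∀ a, M.obj (op (L a))) {K : O} (a : ι) (φ : K ⟶ L a) :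
    (B.desc m).app (op K) (P.map φ.op (B.p a)) = M.map φ.op (m a) := by
  rw [← B.basis_apply]
  exact Module.Basis.constr_basis (S := ℕ) (B.basis K) _ _

theorem desc_app (m : ∀ a, M.obj (op (L a))) (a : ι) :
    (B.desc m).app (op (L a)) (B.p a) = m a := by
  simpa using B.desc_app_map m a (𝟙 _)

theorem hom_ext {f g : P ⟶ M} (h : ∀ a, f.app _ (B.p a) = g.app _ (B.p a)) : f = g := by
  ext K : 3
  refine (B.basis K.unop).ext fun ⟨a, φ⟩ => ?_
  rw [B.basis_apply]
  refine (NatTrans.naturality_apply f φ.op (B.p a)).trans ?_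
  rw [h]
  exact (NatTrans.naturality_apply g φ.op (B.p a)).symm

-- By Yoneda a morphism out of `P` is a free choice of values on the universal elements, and
-- epimorphisms of presheaves are pointwise surjective, so these values can be lifted one by one.
include B in
theorem projective : Projective P where
  factors {E X} f e he := by
    have hs : ∀ a, ∃ x, e.app (op (L a)) x = f.app _ (B.p a) := fun a => by
      have : Epi (e.app (op (L a))) := inferInstance
      exact (ModuleCat.epi_iff_surjective _).mp this _
    choose m hm using hs
    refine ⟨B.desc m, B.hom_ext fun a => ?_⟩
    rw [← hm]
    exact congrArg _ (B.desc_app m a)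

end RepBasis

/-- The direct sum of the presheaves `ℤ[Hom(-, L a)]`. -/
def sumRep (L : ι → O) : Oᵒᵖ ⥤ ModuleCat.{0} ℤ where
  obj K := ModuleCat.of ℤ ((Σ a, K.unop ⟶ L a) →₀ ℤ)
  map ψ := ModuleCat.ofHom (Finsupp.lmapDomain ℤ ℤ fun x => ⟨x.1, ψ.unop ≫ x.2⟩)
  map_id K := by
    ext : 1
    refine Finsupp.lhom_ext' fun x => LinearMap.ext_ring ?_
    simp
  map_comp f g := by
    ext : 1
    refine Finsupp.lhom_ext' fun x => LinearMap.ext_ring ?_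
    simp [Finsupp.mapDomain_single]

namespace sumRep

/-- The basis element of `sumRep` given by a morphism to one of the representing objects. -/
def single (L : ι → O) {K : O} (a : ι) (φ : K ⟶ L a) : (sumRep L).obj (op K) :=
  Finsupp.single (⟨a, φ⟩ : Σ a, K ⟶ L a) (1 : ℤ)

theorem map_single {K K' : O} (ψ : K' ⟶ K) (a : ι) (φ : K ⟶ L a) :
    (sumRep L).map ψ.op (single L a φ) = single L a (ψ ≫ φ) :=
  Finsupp.mapDomain_single

/-- The tautological presentation of `sumRep`. -/
def repBasis (L : ι → O) : RepBasis (sumRep L) L where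
  p a := single L a (𝟙 _)
  basis K := (Finsupp.basisSingleOne : Module.Basis (Σ a, K ⟶ L a) ℤ _)
  basis_apply K a φ := by
    rw [map_single, Category.comp_id]
    exact congrFun Finsupp.coe_basisSingleOne _

variable {M : Oᵒᵖ ⥤ ModuleCat.{0} ℤ}

/-- The morphism out of `sumRep` with prescribed values on the universal elements. -/
def desc (m : ∀ a, M.obj (op (L a))) : sumRep L ⟶ M := (repBasis L).desc m

theorem desc_single (m : ∀ a, M.obj (op (L a))) {K : O} (a : ι) (φ : K ⟶ L a) :
    (desc m).app (op K) (single L a φ) = M.map φ.op (m a) := by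
  have h := (repBasis L).desc_app_map m a φ
  have h' : (sumRep L).map φ.op ((repBasis L).p a) = single L a φ := by
    refine (map_single φ a (𝟙 _)).trans ?_
    rw [Category.comp_id]
  rwa [h'] at h

theorem hom_ext {f g : sumRep L ⟶ M}
    (h : ∀ a, f.app _ (single L a (𝟙 _)) = g.app _ (single L a (𝟙 _))) : f = g :=
  (repBasis L).hom_ext h

theorem linearMap_ext {K : O} {A : Type} [AddCommGroup A] [Module ℤ A]
    {f g : (sumRep L).obj (op K) →ₗ[ℤ] A}
    (h : ∀ a φ, f (single L a φ) = g (single L a φ)) : f = g :=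
  Finsupp.lhom_ext' fun x => LinearMap.ext_ring (h x.1 x.2)

end sumRep

end RepBasis

/-! ### The bar complex relative to a family of tuples -/

section RelBar

variable {G : Type} [Group G]

/-- The orbit `G/e`. -/
abbrev orbitE (G : Type) [Group G] : OrbitCat G := ⟨⊥⟩

/-- A family of sets of tuples which is closed under the face maps of the bar construction. -/
structure FaceClosed (p : ∀ i, Set (Fin i → G)) : Prop where
  tail : ∀ {i} {t : Fin (i + 1) → G}, t ∈ p (i + 1) → (fun k => t k.succ) ∈ p i
  contract : ∀ {i} {t : Fin (i + 1) → G}, t ∈ p (i + 1) →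
    ∀ j : Fin (i + 1), Fin.contractNth j (· * ·) t ∈ p i

variable (p : ∀ i, Set (Fin i → G))

/-- The terms of the bar complex relative to a family of tuples, induced up to coefficient
systems. -/
def relBarX (i : ℕ) : CoeffSystem G :=
  sumRep fun _ : {t : Fin i → G // t ∉ p i} => orbitE G

open Classical in
/-- The class in the relative bar complex of a tuple, which is zero if the tuple belongs to the
family. -/
def relBarMk {i : ℕ} {K : OrbitCat G} (φ : K ⟶ orbitE G) (t : Fin i → G) :
    (relBarX p i).obj (op K) :=
  if h : t ∈ p i then 0
  else sumRep.single (fun _ : {t : Fin i → G // t ∉ p i} => orbitE G) ⟨t, h⟩ φ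

theorem relBarMk_of_mem {i : ℕ} {K : OrbitCat G} (φ : K ⟶ orbitE G) {t : Fin i → G}
    (h : t ∈ p i) : relBarMk p φ t = 0 := dif_pos h

theorem relBarMk_of_notMem {i : ℕ} {K : OrbitCat G} (φ : K ⟶ orbitE G) {t : Fin i → G}
    (h : t ∉ p i) : relBarMk p φ t =
      sumRep.single (fun _ : {t : Fin i → G // t ∉ p i} => orbitE G) ⟨t, h⟩ φ := dif_neg h

theorem relBarX_map_mk {i : ℕ} {K K' : OrbitCat G} (ψ : K' ⟶ K) (φ : K ⟶ orbitE G)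
    (t : Fin i → G) :
    (relBarX p i).map ψ.op (relBarMk p φ t) = relBarMk p (ψ ≫ φ) t := by
  by_cases h : t ∈ p i
  · rw [relBarMk_of_mem p _ h, relBarMk_of_mem p _ h, map_zero]
  · rw [relBarMk_of_notMem p _ h, relBarMk_of_notMem p _ h]
    exact sumRep.map_single _ _ _

theorem relBarX_projective (i : ℕ) : Projective (relBarX p i) :=
  (sumRep.repBasis _).projective

variable {p} in
theorem relBarX_hom_ext {i : ℕ} {M : CoeffSystem G} {f g : relBarX p i ⟶ M}
    (h : ∀ t, t ∉ p i → f.app _ (relBarMk p (𝟙 _) t) = g.app _ (relBarMk p (𝟙 _) t)) : f = g := by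
  refine sumRep.hom_ext fun ⟨t, ht⟩ => ?_
  have := h t ht
  rwa [relBarMk_of_notMem p _ ht] at this

variable {p} in
theorem relBarX_linearMap_ext {i : ℕ} {K : OrbitCat G} {A : Type} [AddCommGroup A] [Module ℤ A]
    {f g : (relBarX p i).obj (op K) →ₗ[ℤ] A}
    (h : ∀ φ t, t ∉ p i → f (relBarMk p φ t) = g (relBarMk p φ t)) : f = g := by
  refine sumRep.linearMap_ext fun ⟨t, ht⟩ φ => ?_
  have := h φ t ht
  rwa [relBarMk_of_notMem p _ ht] at this

variable {p} in
/-- The morphism out of a term of the relative bar complex with prescribed values on tuples. -/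
def relBarDesc {i : ℕ} {M : CoeffSystem G} (f : (Fin i → G) → M.obj (op (orbitE G))) :
    relBarX p i ⟶ M :=
  sumRep.desc fun t => f t.1

theorem relBarDesc_mk {i : ℕ} {M : CoeffSystem G} (f : (Fin i → G) → M.obj (op (orbitE G)))
    (hf : ∀ t ∈ p i, f t = 0) {K : OrbitCat G} (φ : K ⟶ orbitE G) (t : Fin i → G) :
    (relBarDesc f).app (op K) (relBarMk p φ t) = M.map φ.op (f t) := by
  by_cases h : t ∈ p i
  · rw [relBarMk_of_mem p _ h, map_zero, hf t h, map_zero]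
  · rw [relBarMk_of_notMem p _ h]
    exact sumRep.desc_single (L := fun _ : {t : Fin i → G // t ∉ p i} => orbitE G)
      (fun t => f t.1) ⟨t, h⟩ φ

/-- The boundary of a tuple in the relative bar complex. -/
def relBarBoundary {i : ℕ} {K : OrbitCat G} (φ : K ⟶ orbitE G) (t : Fin (i + 1) → G) :
    (relBarX p i).obj (op K) :=
  relBarMk p (φ ≫ rightTranslation (t 0)) (fun k => t k.succ) +
    ∑ j : Fin (i + 1), (-1 : ℤ) ^ ((j : ℕ) + 1) • relBarMk p φ (Fin.contractNth j (· * ·) t)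

-- This is where closure under faces is needed: it makes the bar differential descend to the
-- quotient by the family.
variable {p} in
theorem relBarBoundary_of_mem (hp : FaceClosed p) {i : ℕ} {K : OrbitCat G} (φ : K ⟶ orbitE G)
    {t : Fin (i + 1) → G} (h : t ∈ p (i + 1)) : relBarBoundary p φ t = 0 := by
  rw [relBarBoundary, relBarMk_of_mem p _ (hp.tail h), zero_add]
  refine Finset.sum_eq_zero fun j _ => ?_
  rw [relBarMk_of_mem p _ (hp.contract h j), zsmul_zero]

/-- The differential of the relative bar complex. -/
def relBarD (i : ℕ) : relBarX p (i + 1) ⟶ relBarX p i :=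
  relBarDesc fun t => relBarBoundary p (𝟙 _) t

variable {p} (hp : FaceClosed p)
include hp

theorem relBarD_mk {i : ℕ} {K : OrbitCat G} (φ : K ⟶ orbitE G) (t : Fin (i + 1) → G) :
    (relBarD p i).app (op K) (relBarMk p φ t) = relBarBoundary p φ t := by
  rw [relBarD, relBarDesc_mk p _ fun t h => relBarBoundary_of_mem hp _ h]
  simp only [relBarBoundary, map_add, map_sum, map_zsmul, relBarX_map_mk, Category.comp_id,
    Category.id_comp]

omit hp in
variable (p) in
/-- The values on tuples of a morphism out of a term of the relative bar complex. -/
def relBarEval (i : ℕ) (M : CoeffSystem G) :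
    (relBarX p i ⟶ M) →+ ((Fin i → G) → M.atE) where
  toFun η t := η.app (op (orbitE G)) (relBarMk p (𝟙 _) t)
  map_zero' := rfl
  map_add' _ _ := rfl

omit hp in
theorem relBarEval_injective (i : ℕ) (M : CoeffSystem G) :
    Function.Injective (relBarEval p i M) :=
  fun _ _ h => relBarX_hom_ext fun t _ => congrFun h t

/-- Under Yoneda, precomposition with the bar differential is the inhomogeneous differential. The
zeroth face carries a right translation by `t 0`, which naturality of `η` turns into the action of
`t 0` on `M.atE`. -/
theorem relBarEval_comp_d {i : ℕ} {M : CoeffSystem G} (η : relBarX p i ⟶ M) :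
    relBarEval p (i + 1) M (relBarD p i ≫ η) =
      (inhomogeneousCochains.d M.atE i).hom (relBarEval p i M η) := by
  funext t
  rw [inhomogeneousCochains.d_hom_apply]
  change η.app _ ((relBarD p i).app _ (relBarMk p (𝟙 _) t)) = _
  rw [relBarD_mk hp, relBarBoundary, map_add, map_sum]
  congr 1
  · rw [Category.id_comp]
    have h : (relBarX p i).map (rightTranslation (t 0)).op (relBarMk p (𝟙 _) fun k => t k.succ) =
        relBarMk p (rightTranslation (t 0)) fun k => t k.succ := by
      rw [relBarX_map_mk, Category.comp_id]
    rw [← h]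
    exact NatTrans.naturality_apply η (rightTranslation (t 0)).op _
  · refine Finset.sum_congr rfl fun j _ => ?_
    rw [map_zsmul]
    exact (int_smul_eq_zsmul _ _ _).symm

/-- No new sign computation: take the complex's own term as coefficients. The identity is then a
universal cochain, and the claim is that its inhomogeneous differential squares to zero. -/
theorem relBarD_comp_d (i : ℕ) : relBarD p (i + 1) ≫ relBarD p i = 0 := by
  refine relBarEval_injective _ _ ?_
  have h := relBarEval_comp_d hp (i := i) (𝟙 _)
  rw [Category.comp_id] at h
  rw [relBarEval_comp_d hp, h, map_zero]
  exact LinearMap.congr_fun (congrArg ModuleCat.Hom.hom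
    (groupCohomology.inhomogeneousCochains.d_comp_d i (CoeffSystem.atE (relBarX p i)))) _

/-- The relative bar complex. -/
def relBar : ChainComplex (CoeffSystem G) ℕ :=
  ChainComplex.of (relBarX p) (relBarD p) (relBarD_comp_d hp)

theorem relBar_d (i : ℕ) : (relBar hp).d (i + 1) i = relBarD p i :=
  ChainComplex.of_d _ _ _

end RelBar

/-! ### Faces of a tuple with a prepended entry -/

theorem Fin.contractNth_zero_cons {α : Type} (op : α → α → α) {i : ℕ} (a : α)
    (t : Fin (i + 1) → α) :
    Fin.contractNth 0 op (Fin.cons a t : Fin (i + 2) → α) =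
      Fin.cons (op a (t 0)) fun k : Fin i => t k.succ := by
  funext k
  refine Fin.cases ?_ (fun k => ?_) k
  · simp [Fin.contractNth]
  · simp [Fin.contractNth]

theorem Fin.contractNth_succ_cons {α : Type} (op : α → α → α) {i : ℕ} (a : α)
    (t : Fin (i + 1) → α) (j : Fin (i + 1)) :
    Fin.contractNth j.succ op (Fin.cons a t : Fin (i + 2) → α) =
      Fin.cons a (Fin.contractNth j op t) := by
  funext k
  refine Fin.cases ?_ (fun k => ?_) k
  · simp [Fin.contractNth]
  · simp [Fin.contractNth]

/-! ### Maps of orbits as fixed cosets -/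

section Orbits

variable {G : Type} [Group G]

/-- The image of the base point under a morphism of orbits. -/
def orbitHomElt {K L : OrbitCat G} (φ : K ⟶ L) : G ⧸ L.sub :=
  MulActionHom.toFun φ ((1 : G) : G ⧸ K.sub)

theorem orbitHomElt_smul {K L : OrbitCat G} (φ : K ⟶ L) (g : G) :
    MulActionHom.toFun φ (g : G ⧸ K.sub) = g • orbitHomElt φ := by
  have h := MulActionHom.map_smul' φ g ((1 : G) : G ⧸ K.sub)
  rw [MulAction.Quotient.smul_coe, smul_eq_mul, mul_one] at h
  exact h

theorem orbitHomElt_injective {K L : OrbitCat G} :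
    Function.Injective (orbitHomElt : (K ⟶ L) → G ⧸ L.sub) := by
  intro φ ψ h
  refine MulActionHom.ext fun x => ?_
  induction x using Quotient.inductionOn' with
  | h x => exact (orbitHomElt_smul φ x).trans ((congrArg (x • ·) h).trans
      (orbitHomElt_smul ψ x).symm)

theorem orbitHomElt_smul_eq {K L : OrbitCat G} (φ : K ⟶ L) (k : K.sub) :
    (k : G) • orbitHomElt φ = orbitHomElt φ := by
  rw [← orbitHomElt_smul]
  have : ((k : G) : G ⧸ K.sub) = ((1 : G) : G ⧸ K.sub) := by
    rw [QuotientGroup.eq]; simp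
  rw [this]
  rfl

theorem orbitHomElt_comp {K L P : OrbitCat G} (φ : K ⟶ L) (ψ : L ⟶ P) (g : G)
    (hg : orbitHomElt φ = (g : G ⧸ L.sub)) : orbitHomElt (φ ≫ ψ) = g • orbitHomElt ψ := by
  rw [← orbitHomElt_smul, ← hg]
  rfl

/-- The morphism `G/K → G/L` which sends the base point to a given coset fixed by `K`. -/
def orbitHomMk {K L : OrbitCat G} (q : G ⧸ L.sub) (h : ∀ k ∈ K.sub, k • q = q) : K ⟶ L :=
  show (G ⧸ K.sub) →[G] (G ⧸ L.sub) from
  { toFun := orbitMap (G ⧸ L.sub) (L := K.sub) ⟨q, fun k => h k k.2⟩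
    map_smul' := orbitMap_smul _ _ }

theorem orbitHomElt_mk {K L : OrbitCat G} (q : G ⧸ L.sub) (h : ∀ k ∈ K.sub, k • q = q) :
    orbitHomElt (orbitHomMk (K := K) q h) = q :=
  one_smul G q

theorem orbitHomElt_rightTranslation (g : G) :
    orbitHomElt (rightTranslation g) = (g : G ⧸ (⊥ : Subgroup G)) := by
  change (Quotient.mk'' (1 * g) : G ⧸ (⊥ : Subgroup G)) = _
  rw [one_mul]

theorem rightTranslation_injective :
    Function.Injective (rightTranslation : G → (orbitE G ⟶ orbitE G)) := by
  intro g h e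
  have := congrArg orbitHomElt e
  rw [orbitHomElt_rightTranslation, orbitHomElt_rightTranslation, QuotientGroup.eq,
    Subgroup.mem_bot] at this
  exact inv_mul_eq_one.mp this

theorem rightTranslation_surjective :
    Function.Surjective (rightTranslation : G → (orbitE G ⟶ orbitE G)) := by
  intro φ
  obtain ⟨g, hg⟩ := QuotientGroup.mk_surjective (orbitHomElt φ)
  exact ⟨g, orbitHomElt_injective ((orbitHomElt_rightTranslation g).trans hg)⟩

/-- Points of G/e have trivial stabilizer. Hence the terms of the bar complexes are nonzero only at
G/e, where exactness becomes a statement about ordinary modules. -/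
theorem sub_eq_bot_of_hom {K : OrbitCat G} (φ : K ⟶ orbitE G) : K = orbitE G := by
  obtain ⟨K⟩ := K
  congr
  refine (Subgroup.eq_bot_iff_forall K).mpr fun k hk => ?_
  obtain ⟨g, hg⟩ := QuotientGroup.mk_surjective (orbitHomElt φ)
  have h := orbitHomElt_smul_eq φ ⟨k, hk⟩
  rw [← hg, MulAction.Quotient.smul_coe, QuotientGroup.eq, Subgroup.mem_bot] at h
  have h' := congrArg (fun x => g * x * g⁻¹) h
  simpa [mul_assoc] using h'

end Orbits

/-! ### Projective resolutions recognized pointwise -/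

section Resolution

variable {O : Type} [SmallCategory O]

theorem presheaf_exact_of_app {S : ShortComplex (Oᵒᵖ ⥤ ModuleCat.{0} ℤ)}
    (h : ∀ K, Function.Exact (S.f.app K) (S.g.app K)) : S.Exact := by
  rw [ShortComplex.exact_iff_isZero_homology]
  refine (Functor.isZero_iff _).mpr fun K => ?_
  have e : S.homology.obj K ≅ (S.map ((evaluation _ _).obj K)).homology :=
    (S.mapHomologyIso ((evaluation _ _).obj K)).symm
  refine IsZero.of_iso ?_ e
  rw [← ShortComplex.exact_iff_isZero_homology, ShortComplex.ShortExact.moduleCat_exact_iff_function_exact]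
  exact h K

/-- A chain complex of projective presheaves of abelian groups with a pointwise exact augmentation
is a projective resolution. -/
def projectiveResolutionOfExact (C : ChainComplex (Oᵒᵖ ⥤ ModuleCat.{0} ℤ) ℕ)
    (hC : ∀ n, Projective (C.X n)) {Z : Oᵒᵖ ⥤ ModuleCat.{0} ℤ} (ε : C.X 0 ⟶ Z)
    (hε : ∀ K, Function.Surjective (ε.app K))
    (h₀ : ∀ K, Function.Exact ((C.d 1 0).app K) (ε.app K))
    (h : ∀ n K, Function.Exact ((C.d (n + 2) (n + 1)).app K) ((C.d (n + 1) n).app K)) :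
    ProjectiveResolution Z :=
  have w : C.d 1 0 ≫ ε = 0 := by
    ext K x
    exact (h₀ K).apply_apply_eq_zero x
  { complex := C
    projective := hC
    π := (ChainComplex.toSingle₀Equiv C Z).symm ⟨ε, w⟩
    quasiIso := ⟨fun i => by
      cases i with
      | zero =>
        rw [ChainComplex.quasiIsoAt₀_iff, ShortComplex.quasiIso_iff_of_zeros']
        rotate_left
        · exact C.shape _ _ (by simp)
        · rfl
        · rfl
        · constructor
          · refine presheaf_exact_of_app fun K => ?_
            have := h₀ K
            simpa using! this
          · have : Epi ε := by
              have : ∀ K, Epi (ε.app K) := fun K => (ModuleCat.epi_iff_surjective _).mpr (hε K)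
              exact NatTrans.epi_of_epi_app _
            simpa using! this
      | succ i =>
        rw [quasiIsoAt_iff_exactAt']
        · rw [HomologicalComplex.exactAt_iff' _ (i + 2) (i + 1) i (by simp) (by simp)]
          exact presheaf_exact_of_app (h i)
        · exact ChainComplex.exactAt_succ_single_obj _ _⟩ }

end Resolution

/-! ### Exactness of the relative bar complex at the free orbit -/

section RelativeResolution

variable {G : Type} [Group G]

theorem faceClosed_empty : FaceClosed fun i => (∅ : Set (Fin i → G)) where
  tail h := h.elim
  contract h := h.elim

/-- The tuples of elements of a subgroup. -/
def tuplesIn (H : Subgroup G) (i : ℕ) : Set (Fin i → G) := {t | ∀ k, t k ∈ H}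

theorem faceClosed_tuplesIn (H : Subgroup G) : FaceClosed (tuplesIn H) where
  tail h k := h k.succ
  contract h j k := by
    unfold Fin.contractNth
    split_ifs
    · exact h _
    · exact H.mul_mem (h _) (h _)
    · exact h _

/-- A linear map out of a value of a term of the relative bar complex with prescribed values on
the basis. -/
def relBarLift {p : ∀ i, Set (Fin i → G)} {i : ℕ} {K : OrbitCat G} {A : Type} [AddCommGroup A]
    [Module ℤ A] (f : (K ⟶ orbitE G) → (Fin i → G) → A) :
    (relBarX p i).obj (op K) →ₗ[ℤ] A :=
  Finsupp.linearCombination ℤ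
    fun x : Σ _ : {t : Fin i → G // t ∉ p i}, K ⟶ orbitE G => f x.2 x.1.1

theorem relBarLift_mk {p : ∀ i, Set (Fin i → G)} {i : ℕ} {K : OrbitCat G} {A : Type}
    [AddCommGroup A] [inst : Module ℤ A] (f : (K ⟶ orbitE G) → (Fin i → G) → A) (φ : K ⟶ orbitE G)
    {t : Fin i → G} (ht : t ∉ p i) : relBarLift f (relBarMk p φ t) = f φ t := by
  rw [relBarMk_of_notMem p φ ht]
  exact (Finsupp.linearCombination_single ℤ _ _).trans (inst.one_smul _)

/-- The value at `G/e` of a term of the unnormalized bar complex. -/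
abbrev barE (G : Type) [Group G] (i : ℕ) : Type :=
  (relBarX (fun i => (∅ : Set (Fin i → G))) i).obj (op (orbitE G))

/-- A basis element of the bar complex. -/
abbrev barMk {i : ℕ} (x : G) (t : Fin i → G) : barE G i :=
  relBarMk (fun i => (∅ : Set (Fin i → G))) (rightTranslation x) t

/-- The differential of the bar complex. -/
def barD (G : Type) [Group G] (i : ℕ) : barE G (i + 1) →ₗ[ℤ] barE G i :=
  ((relBarD (fun i => (∅ : Set (Fin i → G))) i).app (op (orbitE G))).hom

theorem barD_mk {i : ℕ} (x : G) (t : Fin (i + 1) → G) :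
    barD G i (barMk x t) = barMk (x * t 0) (fun k => t k.succ) +
      ∑ j : Fin (i + 1), (-1 : ℤ) ^ ((j : ℕ) + 1) • barMk x (Fin.contractNth j (· * ·) t) := by
  refine (relBarD_mk faceClosed_empty (rightTranslation x) t).trans ?_
  rw [relBarBoundary, ← rightTranslation_mul]

theorem barD_barD {i : ℕ} (b : barE G (i + 2)) : barD G i (barD G (i + 1) b) = 0 :=
  congrArg (fun f => f.app (op (orbitE G)) b) (relBarD_comp_d faceClosed_empty i)

theorem bar_linearMap_ext {i : ℕ} {A : Type} [AddCommGroup A] [Module ℤ A]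
    {f g : barE G i →ₗ[ℤ] A} (h : ∀ x t, f (barMk x t) = g (barMk x t)) : f = g := by
  refine relBarX_linearMap_ext fun φ t _ => ?_
  obtain ⟨x, rfl⟩ := rightTranslation_surjective φ
  exact h x t

/-- The linear map out of the bar complex with prescribed values on the basis. -/
def barLift {i : ℕ} {A : Type} [AddCommGroup A] [Module ℤ A] (f : G → (Fin i → G) → A) :
    barE G i →ₗ[ℤ] A :=
  relBarLift fun φ t => f (Function.surjInv rightTranslation_surjective φ) t

theorem barLift_mk {i : ℕ} {A : Type} [AddCommGroup A] [Module ℤ A] (f : G → (Fin i → G) → A)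
    (x : G) (t : Fin i → G) : barLift f (barMk x t) = f x t := by
  refine (relBarLift_mk _ _ (Set.notMem_empty _)).trans ?_
  rw [rightTranslation_injective (Function.surjInv_eq rightTranslation_surjective
    (rightTranslation x))]

/-- The contraction of the bar complex towards the images of a map `σ`. -/
def barContract (σ : G → G) (i : ℕ) : barE G i →ₗ[ℤ] barE G (i + 1) :=
  barLift fun x t => barMk (σ x) (Fin.cons ((σ x)⁻¹ * x) t)

theorem barContract_mk (σ : G → G) {i : ℕ} (x : G) (t : Fin i → G) :
    barContract σ i (barMk x t) = barMk (σ x) (Fin.cons ((σ x)⁻¹ * x) t) :=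
  barLift_mk _ _ _

/-- View `barMk x t` as the simplex with vertices x, x t₀, x t₀ t₁, …; the contraction prepends the
vertex σ(x). All faces cancel except the original simplex, but the face dropping x cancels only if σ
takes the same value at the next vertex. With σ = 1 this contracts the whole bar complex; with σ a
choice of coset representatives it contracts the part over H. -/
theorem barD_barContract_mk (σ : G → G) {i : ℕ} (x : G) (t : Fin (i + 1) → G)
    (h : σ (x * t 0) = σ x) :
    barD G (i + 1) (barContract σ (i + 1) (barMk x t)) + barContract σ i (barD G i (barMk x t)) =
      barMk x t := by
  rw [barContract_mk, barD_mk, barD_mk, map_add, map_sum, barContract_mk, h, Fin.sum_univ_succ,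
    Fin.contractNth_zero_cons]
  simp only [Fin.contractNth_succ_cons, map_zsmul, barContract_mk, Fin.cons_zero, Fin.cons_succ,
    Fin.val_zero, Fin.val_succ, mul_inv_cancel_left, zero_add, pow_one, neg_zsmul, one_zsmul,
    pow_succ (-1 : ℤ) (_ + 1), mul_neg, mul_one, Finset.sum_neg_distrib, mul_assoc]
  abel

/-- In degree zero the prepended vertex σ(x) survives as the second face, so the contraction misses
the identity by σ. -/
theorem barD_barContract_mk_zero (σ : G → G) (x : G) (t : Fin 0 → G) :
    barD G 0 (barContract σ 0 (barMk x t)) = barMk x t - barMk (σ x) t := by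
  rw [barContract_mk, barD_mk]
  simp only [Fin.cons_zero, mul_inv_cancel_left, Fin.cons_succ, Fin.sum_univ_succ, Fin.val_zero,
    zero_add, pow_one, neg_zsmul, one_zsmul, Finset.univ_eq_empty, Finset.sum_empty, add_zero,
    sub_eq_add_neg]
  congr 3
  exact Subsingleton.elim _ _

theorem barD_barContract_one {i : ℕ} (b : barE G (i + 1)) :
    barD G (i + 1) (barContract (fun _ => 1) (i + 1) b) +
      barContract (fun _ => 1) i (barD G i b) = b := by
  have : barD G (i + 1) ∘ₗ barContract (fun _ => 1) (i + 1) +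
      barContract (fun _ => 1) i ∘ₗ barD G i = LinearMap.id :=
    bar_linearMap_ext fun x t => barD_barContract_mk _ x t rfl
  exact LinearMap.congr_fun this b

variable (H : Subgroup G)

/-- The projection `G/e → G/H`. -/
def orbitProj : orbitE G ⟶ (⟨H⟩ : OrbitCat G) :=
  orbitHomMk ((1 : G) : G ⧸ H) fun k hk => by
    rw [Subgroup.mem_bot.mp hk, one_smul]

theorem orbitHomElt_rightTranslation_proj (x : G) :
    orbitHomElt (rightTranslation x ≫ orbitProj H) = (x : G ⧸ H) := by
  rw [orbitHomElt_comp _ _ x (orbitHomElt_rightTranslation x), orbitProj, orbitHomElt_mk,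
    MulAction.Quotient.smul_coe, smul_eq_mul, mul_one]

theorem rightTranslation_comp_orbitProj {h : G} (hh : h ∈ H) :
    rightTranslation h ≫ orbitProj H = orbitProj H := by
  refine orbitHomElt_injective ?_
  rw [orbitHomElt_rightTranslation_proj, orbitProj, orbitHomElt_mk, QuotientGroup.eq]
  simpa using hh

/-- The linearization of the presheaf represented by `G/H`. -/
def repH : CoeffSystem G := sumRep fun _ : Unit => (⟨H⟩ : OrbitCat G)

/-- The basis elements of `repH`. -/
def repH.mk {K : OrbitCat G} (φ : K ⟶ (⟨H⟩ : OrbitCat G)) : (repH H).obj (op K) :=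
  sumRep.single (fun _ : Unit => (⟨H⟩ : OrbitCat G)) () φ

theorem repH.map_mk {K K' : OrbitCat G} (ψ : K' ⟶ K) (φ : K ⟶ (⟨H⟩ : OrbitCat G)) :
    (repH H).map ψ.op (repH.mk H φ) = repH.mk H (ψ ≫ φ) :=
  sumRep.map_single _ _ _

theorem repH.linearMap_ext {K : OrbitCat G} {A : Type} [AddCommGroup A] [Module ℤ A]
    {f g : (repH H).obj (op K) →ₗ[ℤ] A}
    (h : ∀ φ, f (repH.mk H φ) = g (repH.mk H φ)) : f = g :=
  sumRep.linearMap_ext fun _ φ => h φ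

/-- A linear map out of a value of `repH` with prescribed values on the basis. -/
def repH.lift {K : OrbitCat G} {A : Type} [AddCommGroup A] [Module ℤ A]
    (f : (K ⟶ (⟨H⟩ : OrbitCat G)) → A) : (repH H).obj (op K) →ₗ[ℤ] A :=
  Finsupp.linearCombination ℤ fun x : Σ _ : Unit, K ⟶ (⟨H⟩ : OrbitCat G) => f x.2

theorem repH.lift_mk {K : OrbitCat G} {A : Type} [AddCommGroup A] [inst : Module ℤ A]
    (f : (K ⟶ (⟨H⟩ : OrbitCat G)) → A) (φ : K ⟶ (⟨H⟩ : OrbitCat G)) :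
    repH.lift H f (repH.mk H φ) = f φ :=
  (Finsupp.linearCombination_single ℤ _ _).trans (inst.one_smul _)

/-- The coefficient system with value `ℤ` at the orbits which map to `G/H`, and zero elsewhere. -/
def supportZ : CoeffSystem G where
  obj K := ModuleCat.of ℤ (PLift (Nonempty (K.unop ⟶ (⟨H⟩ : OrbitCat G))) →₀ ℤ)
  map ψ := ModuleCat.ofHom (Finsupp.lmapDomain ℤ ℤ fun h => ⟨h.down.map fun φ => ψ.unop ≫ φ⟩)
  map_id K := by
    ext : 1
    refine Finsupp.lhom_ext' fun x => LinearMap.ext_ring ?_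
    simp
  map_comp f g := by
    ext : 1
    refine Finsupp.lhom_ext' fun x => LinearMap.ext_ring ?_
    simp [Finsupp.mapDomain_single]

/-- The generator of a nonzero value of `supportZ`. -/
def supportZ.one {K : OrbitCat G} (h : Nonempty (K ⟶ (⟨H⟩ : OrbitCat G))) :
    (supportZ H).obj (op K) :=
  Finsupp.single (PLift.up h) (1 : ℤ)

theorem supportZ.map_one {K K' : OrbitCat G} (ψ : K' ⟶ K)
    (h : Nonempty (K ⟶ (⟨H⟩ : OrbitCat G))) (h' : Nonempty (K' ⟶ (⟨H⟩ : OrbitCat G))) :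
    (supportZ H).map ψ.op (supportZ.one H h) = supportZ.one H h' :=
  Finsupp.mapDomain_single

/-- The augmentation of `repH`. -/
def repHAug : repH H ⟶ supportZ H :=
  sumRep.desc fun _ => supportZ.one H ⟨𝟙 _⟩

theorem repHAug_mk {K : OrbitCat G} (φ : K ⟶ (⟨H⟩ : OrbitCat G)) :
    (repHAug H).app (op K) (repH.mk H φ) = supportZ.one H ⟨φ⟩ :=
  (sumRep.desc_single (L := fun _ : Unit => (⟨H⟩ : OrbitCat G)) _ _ _).trans
    (supportZ.map_one H φ _ _)

theorem repHAug_surjective (K : (OrbitCat G)ᵒᵖ) : Function.Surjective ((repHAug H).app K) := by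
  have h : LinearMap.range ((repHAug H).app K).hom = ⊤ := by
    refine eq_top_iff.mpr fun x _ => ?_
    refine Finsupp.induction_linear (motive := fun x : PLift (Nonempty (K.unop ⟶
      (⟨H⟩ : OrbitCat G))) →₀ ℤ => x ∈ LinearMap.range ((repHAug H).app K).hom) x
      (Submodule.zero_mem _) (fun _ _ => Submodule.add_mem _) fun ⟨⟨φ⟩⟩ n => ?_
    refine ⟨n • repH.mk H φ, ?_⟩
    refine (map_zsmul ((repHAug H).app K).hom n _).trans ?_
    refine (congrArg (n • ·) (repHAug_mk H φ)).trans ?_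
    refine (Finsupp.smul_single n _ (1 : ℤ)).trans ?_
    rw [smul_eq_mul, mul_one]
  exact LinearMap.range_eq_top.mp h

/-- The augmentation is induced by a map of bases, collapsing all maps to G/H to one generator; it
is injective when there is at most one such map. -/
theorem repHAug_injective {K : OrbitCat G} [Subsingleton (K ⟶ (⟨H⟩ : OrbitCat G))] :
    Function.Injective ((repHAug H).app (op K)) := by
  let f : (Σ _ : Unit, K ⟶ (⟨H⟩ : OrbitCat G)) → PLift (Nonempty (K ⟶ (⟨H⟩ : OrbitCat G))) :=
    fun x => ⟨⟨x.2⟩⟩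
  have h : ((repHAug H).app (op K)).hom = Finsupp.lmapDomain ℤ ℤ f :=
    repH.linearMap_ext H fun φ => (repHAug_mk H φ).trans
      (Finsupp.mapDomain_single (f := f) (a := ⟨(), φ⟩) (b := (1 : ℤ))).symm
  have hf : Function.Injective f := fun x y _ => by
    obtain ⟨_, x⟩ := x
    obtain ⟨_, y⟩ := y
    rw [Subsingleton.elim x y]
  have := Finsupp.mapDomain_injective (M := ℤ) hf
  intro x y hxy
  refine this ?_
  have e : ∀ x, ((repHAug H).app (op K)) x = Finsupp.mapDomain f x :=
    fun x => LinearMap.congr_fun h x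
  rw [← e x, ← e y, hxy]

/-- The last differential of the relative resolution. -/
def relBarAug : relBarX (tuplesIn H) 1 ⟶ repH H :=
  relBarDesc fun t => repH.mk H (rightTranslation (t 0) ≫ orbitProj H) - repH.mk H (orbitProj H)

theorem relBarAug_mk {K : OrbitCat G} (φ : K ⟶ orbitE G) (t : Fin 1 → G) :
    (relBarAug H).app (op K) (relBarMk _ φ t) =
      repH.mk H (φ ≫ rightTranslation (t 0) ≫ orbitProj H) - repH.mk H (φ ≫ orbitProj H) := by
  rw [relBarAug, relBarDesc_mk, map_sub, repH.map_mk, repH.map_mk]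
  intro t ht
  -- For an entry in H both vertices project to the same coset, so the prescribed value vanishes on
  -- the subcomplex.
  rw [rightTranslation_comp_orbitProj H (ht 0), sub_self]

theorem relBarD_comp_aug : relBarD (tuplesIn H) 1 ≫ relBarAug H = 0 := by
  refine relBarX_hom_ext fun t _ => ?_
  change (relBarAug H).app _ ((relBarD (tuplesIn H) 1).app _ (relBarMk _ (𝟙 _) t)) = 0
  rw [relBarD_mk (faceClosed_tuplesIn H), relBarBoundary, map_add, map_sum]
  simp only [map_zsmul, relBarAug_mk, Fin.sum_univ_succ, Category.id_comp]
  simp [Fin.contractNth, rightTranslation_mul]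

theorem relBarAug_comp_repHAug : relBarAug H ≫ repHAug H = 0 := by
  refine relBarX_hom_ext fun t _ => ?_
  change (repHAug H).app _ ((relBarAug H).app _ (relBarMk _ (𝟙 _) t)) = 0
  rw [relBarAug_mk, map_sub, repHAug_mk, repHAug_mk, sub_self]

/-- The projection of the bar complex to the relative bar complex. -/
def barProj (i : ℕ) : barE G i →ₗ[ℤ] (relBarX (tuplesIn H) i).obj (op (orbitE G)) :=
  barLift fun x t => relBarMk _ (rightTranslation x) t

theorem barProj_mk {i : ℕ} (x : G) (t : Fin i → G) :
    barProj H i (barMk x t) = relBarMk _ (rightTranslation x) t := barLift_mk _ _ _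

theorem barProj_barD {i : ℕ} (b : barE G (i + 1)) :
    barProj H i (barD G i b) = (relBarD (tuplesIn H) i).app _ (barProj H (i + 1) b) := by
  have : barProj H i ∘ₗ barD G i = ((relBarD (tuplesIn H) i).app _).hom ∘ₗ barProj H (i + 1) := by
    refine bar_linearMap_ext fun x t => ?_
    refine Eq.trans ?_ ((congrArg _ (barProj_mk H x t)).trans
      (relBarD_mk (faceClosed_tuplesIn H) _ _)).symm
    refine (congrArg (barProj H i) (barD_mk x t)).trans ?_
    rw [map_add, map_sum, barProj_mk, relBarBoundary, rightTranslation_mul]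
    simp only [map_zsmul, barProj_mk]
  exact LinearMap.congr_fun this b

/-- The section of `barProj`. -/
def barSection (i : ℕ) : (relBarX (tuplesIn H) i).obj (op (orbitE G)) →ₗ[ℤ] barE G i :=
  relBarLift fun φ t => relBarMk _ φ t

theorem barSection_mk {i : ℕ} (x : G) {t : Fin i → G} (ht : t ∉ tuplesIn H i) :
    barSection H i (relBarMk _ (rightTranslation x) t) = barMk x t := relBarLift_mk _ _ ht

theorem barProj_barSection {i : ℕ} (z : (relBarX (tuplesIn H) i).obj (op (orbitE G))) :
    barProj H i (barSection H i z) = z := by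
  have : barProj H i ∘ₗ barSection H i = LinearMap.id := by
    refine relBarX_linearMap_ext fun φ t ht => ?_
    obtain ⟨x, rfl⟩ := rightTranslation_surjective φ
    exact (congrArg _ (barSection_mk H x ht)).trans (barProj_mk H x t)
  exact LinearMap.congr_fun this z

/-- The kernel of `barProj` is spanned by the tuples in H. Instead of naming a spanning set, `T` is
shown to factor through the projection. -/
theorem eq_zero_of_barProj_eq_zero {i : ℕ} {A : Type} [AddCommGroup A] [Module ℤ A]
    (T : barE G i →ₗ[ℤ] A) (hT : ∀ x, ∀ t ∈ tuplesIn H i, T (barMk x t) = 0) {b : barE G i}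
    (hb : barProj H i b = 0) : T b = 0 := by
  have : T = T ∘ₗ barSection H i ∘ₗ barProj H i := by
    refine bar_linearMap_ext fun x t => ?_
    change _ = T (barSection H i (barProj H i (barMk x t)))
    rw [barProj_mk]
    by_cases ht : t ∈ tuplesIn H i
    · rw [relBarMk_of_mem _ _ ht, map_zero, map_zero, hT x t ht]
    · rw [barSection_mk H x ht]
  rw [this]
  change T (barSection H i (barProj H i b)) = 0
  rw [hb, map_zero, map_zero]

/-- A map which picks a representative in each coset. -/
def cosetRep (x : G) : G := Quotient.out (x : G ⧸ H)

theorem cosetRep_mul (x : G) {h : G} (hh : h ∈ H) : cosetRep H (x * h) = cosetRep H x := by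
  unfold cosetRep
  congr 1
  rw [QuotientGroup.eq]
  simpa using hh

theorem cosetRep_inv_mul_mem (x : G) : (cosetRep H x)⁻¹ * x ∈ H := by
  rw [← QuotientGroup.eq]
  exact QuotientGroup.out_eq' _

theorem cons_mem_tuplesIn {i : ℕ} {a : G} {t : Fin i → G} (ha : a ∈ H) (ht : t ∈ tuplesIn H i) :
    (Fin.cons a t : Fin (i + 1) → G) ∈ tuplesIn H (i + 1) :=
  fun k => Fin.cases ha ht k

/-- A vertex and the representative of its coset differ by an element of H, so prepending the
representative stays in the subcomplex over H. -/
theorem barProj_barContract_eq_zero {i : ℕ} {b : barE G i} (hb : barProj H i b = 0) :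
    barProj H (i + 1) (barContract (cosetRep H) i b) = 0 := by
  refine eq_zero_of_barProj_eq_zero H (barProj H (i + 1) ∘ₗ barContract (cosetRep H) i)
    (fun x t ht => ?_) hb
  change barProj H (i + 1) (barContract (cosetRep H) i (barMk x t)) = 0
  rw [barContract_mk, barProj_mk, relBarMk_of_mem]
  exact cons_mem_tuplesIn H (cosetRep_inv_mul_mem H x) ht

/-- All vertices of a simplex in the subcomplex lie in one coset of H and share its representative,
so the contraction identity applies: the subcomplex is acyclic in positive degrees. -/
theorem barD_barContract_cosetRep {i : ℕ} {b : barE G (i + 1)} (hb : barProj H (i + 1) b = 0) :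
    barD G (i + 1) (barContract (cosetRep H) (i + 1) b) +
      barContract (cosetRep H) i (barD G i b) = b := by
  refine sub_eq_zero.mp (eq_zero_of_barProj_eq_zero H (barD G (i + 1) ∘ₗ
    barContract (cosetRep H) (i + 1) + barContract (cosetRep H) i ∘ₗ barD G i - LinearMap.id)
    (fun x t ht => ?_) hb)
  exact sub_eq_zero.mpr (barD_barContract_mk _ x t (cosetRep_mul H x (ht 0)))

/-- If a cycle of the relative bar complex is represented by an element whose boundary is the
boundary of an element of the subcomplex, then it is a boundary. -/
theorem exists_relBarD_eq {i : ℕ} {b v : barE G (i + 1)} (hv : barProj H (i + 1) v = 0)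
    (hbv : barD G i b = barD G i v) :
    ∃ y, (relBarD (tuplesIn H) (i + 1)).app _ y = barProj H (i + 1) b := by
  -- `b - v` is a cycle of the acyclic bar complex, and it has the same projection as `b`.
  refine ⟨barProj H (i + 2) (barContract (fun _ => 1) (i + 1) (b - v)), ?_⟩
  have h := barD_barContract_one (b - v)
  rw [map_sub (barD G i), hbv, sub_self, map_zero, add_zero] at h
  rw [← barProj_barD, h, map_sub, hv, sub_zero]

/-- The chase of the long exact homology sequence: lift a relative cycle to `b`; its boundary is a
cycle of the subcomplex, hence the boundary of some element there, and `exists_relBarD_eq` applies.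
-/
theorem relBarD_exact_orbitE (i : ℕ) :
    Function.Exact ((relBarD (tuplesIn H) (i + 2)).app (op (orbitE G)))
      ((relBarD (tuplesIn H) (i + 1)).app (op (orbitE G))) := by
  intro z
  constructor
  · intro hz
    have hb := barProj_barSection H z
    set b := barSection H (i + 2) z
    have hw : barProj H (i + 1) (barD G (i + 1) b) = 0 := by rw [barProj_barD, hb, hz]
    have h := barD_barContract_cosetRep H hw
    rw [barD_barD, map_zero, add_zero] at h
    obtain ⟨y, hy⟩ := exists_relBarD_eq H (barProj_barContract_eq_zero H hw) h.symm
    exact ⟨y, hy.trans hb⟩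
  · rintro ⟨y, rfl⟩
    exact congrArg (fun f => f.app (op (orbitE G)) y)
      (relBarD_comp_d (faceClosed_tuplesIn H) (i + 1))

/-- The projection of the bar complex to `ℤ[G/H]` in degree zero. -/
def barProjZero : barE G 0 →ₗ[ℤ] (repH H).obj (op (orbitE G)) :=
  barLift fun x _ => repH.mk H (rightTranslation x ≫ orbitProj H)

theorem barProjZero_mk (x : G) (t : Fin 0 → G) :
    barProjZero H (barMk x t) = repH.mk H (rightTranslation x ≫ orbitProj H) := barLift_mk _ _ _

theorem barProjZero_barD (b : barE G 1) :
    barProjZero H (barD G 0 b) = (relBarAug H).app _ (barProj H 1 b) := by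
  have : barProjZero H ∘ₗ barD G 0 = ((relBarAug H).app _).hom ∘ₗ barProj H 1 := by
    refine bar_linearMap_ext fun x t => ?_
    refine Eq.trans ?_ ((congrArg _ (barProj_mk H x t)).trans (relBarAug_mk H _ _)).symm
    refine (congrArg (barProjZero H) (barD_mk x t)).trans ?_
    rw [map_add, map_sum, barProjZero_mk]
    simp only [map_zsmul, barProjZero_mk, Fin.sum_univ_succ]
    simp [rightTranslation_mul, sub_eq_add_neg]
  exact LinearMap.congr_fun this b

theorem barProj_one_barContract (b : barE G 0) :
    barProj H 1 (barContract (cosetRep H) 0 b) = 0 := by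
  have : barProj H 1 ∘ₗ barContract (cosetRep H) 0 = 0 := by
    refine bar_linearMap_ext fun x t => ?_
    change barProj H 1 (barContract (cosetRep H) 0 (barMk x t)) = 0
    rw [barContract_mk, barProj_mk, relBarMk_of_mem]
    exact cons_mem_tuplesIn H (cosetRep_inv_mul_mem H x) fun k => k.elim0
  exact LinearMap.congr_fun this b

/-- The section of `barProjZero` given by representatives of the cosets. -/
def barSectionZero : (repH H).obj (op (orbitE G)) →ₗ[ℤ] barE G 0 :=
  repH.lift H fun φ => barMk (Quotient.out (orbitHomElt φ)) Fin.elim0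

theorem barSectionZero_mk (φ : orbitE G ⟶ (⟨H⟩ : OrbitCat G)) :
    barSectionZero H (repH.mk H φ) = barMk (Quotient.out (orbitHomElt φ)) Fin.elim0 :=
  repH.lift_mk _ _ _

theorem barProjZero_barSectionZero (z : (repH H).obj (op (orbitE G))) :
    barProjZero H (barSectionZero H z) = z := by
  have hs : barProjZero H ∘ₗ barSectionZero H = LinearMap.id := by
    refine repH.linearMap_ext H fun φ => ?_
    change barProjZero H (barSectionZero H _) = _
    rw [barSectionZero_mk, barProjZero_mk]
    congr 1
    refine orbitHomElt_injective ?_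
    rw [orbitHomElt_rightTranslation_proj]
    exact QuotientGroup.out_eq' _
  exact LinearMap.congr_fun hs z

/-- `barSectionZero` uses the same coset representatives as the contraction, so the defect of the
contraction in degree zero factors through ℤ[G/H]. The zeroth homology of the subcomplex is
therefore ℤ[G/H]. -/
theorem barD_barContract_zero {b : barE G 0} (hb : barProjZero H b = 0) :
    barD G 0 (barContract (cosetRep H) 0 b) = b := by
  have : barD G 0 ∘ₗ barContract (cosetRep H) 0 = LinearMap.id -
      barSectionZero H ∘ₗ barProjZero H := by
    refine bar_linearMap_ext fun x t => ?_
    refine (barD_barContract_mk_zero _ _ _).trans ?_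
    change _ = barMk x t - barSectionZero H (barProjZero H (barMk x t))
    rw [barProjZero_mk, barSectionZero_mk, orbitHomElt_rightTranslation_proj, cosetRep,
      Subsingleton.elim t Fin.elim0]
  refine (LinearMap.congr_fun this b).trans ?_
  change b - barSectionZero H (barProjZero H b) = b
  rw [hb, map_zero, sub_zero]

theorem relBarAug_exact_orbitE :
    Function.Exact ((relBarD (tuplesIn H) 1).app (op (orbitE G)))
      ((relBarAug H).app (op (orbitE G))) := by
  intro z
  constructor
  · intro hz
    have hb := barProj_barSection H z
    set b := barSection H 1 z
    have hw : barProjZero H (barD G 0 b) = 0 := by rw [barProjZero_barD, hb, hz]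
    obtain ⟨y, hy⟩ := exists_relBarD_eq H (barProj_one_barContract H _)
      (barD_barContract_zero H hw).symm
    exact ⟨y, hy.trans hb⟩
  · rintro ⟨y, rfl⟩
    exact congrArg (fun f => f.app (op (orbitE G)) y) (relBarD_comp_aug H)

theorem repHAug_exact_orbitE :
    Function.Exact ((relBarAug H).app (op (orbitE G))) ((repHAug H).app (op (orbitE G))) := by
  intro z
  constructor
  · intro hz
    have hb := barProjZero_barSectionZero H z
    set b := barSectionZero H z
    -- The contraction towards 1 misses the identity by the augmentation followed by the vertex 1,
    -- which is `c`.
    let c : (supportZ H).obj (op (orbitE G)) →ₗ[ℤ] barE G 0 :=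
      Finsupp.linearCombination ℤ fun _ => barMk 1 Fin.elim0
    have hc : barD G 0 ∘ₗ barContract (fun _ => 1) 0 =
        LinearMap.id - c ∘ₗ ((repHAug H).app _).hom ∘ₗ barProjZero H := by
      refine bar_linearMap_ext fun x t => ?_
      refine (barD_barContract_mk_zero _ _ _).trans ?_
      change _ = barMk x t - c ((repHAug H).app _ (barProjZero H (barMk x t)))
      rw [barProjZero_mk, repHAug_mk]
      congr 1
      refine Eq.symm ((Finsupp.linearCombination_single ℤ _ _).trans ?_)
      refine (one_smul ℤ _).trans ?_
      rw [Subsingleton.elim t]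
    have h := LinearMap.congr_fun hc b
    change barD G 0 (barContract _ 0 b) = b - c ((repHAug H).app _ (barProjZero H b)) at h
    rw [hb, hz, map_zero, sub_zero] at h
    exact ⟨_, by rw [← barProjZero_barD, h, hb]⟩
  · rintro ⟨y, rfl⟩
    exact congrArg (fun f => f.app (op (orbitE G)) y) (relBarAug_comp_repHAug H)

end RelativeResolution

/-! ### The relative resolution of `supportZ` -/

section RelativeResolution

variable {G : Type} [Group G] (H : Subgroup G)

theorem relBarX_subsingleton (p : ∀ i, Set (Fin i → G)) (i : ℕ) {K : OrbitCat G}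
    (hK : IsEmpty (K ⟶ orbitE G)) : Subsingleton ((relBarX p i).obj (op K)) := by
  have : IsEmpty (Σ _ : {t : Fin i → G // t ∉ p i}, K ⟶ orbitE G) := ⟨fun x => hK.elim x.2⟩
  exact inferInstanceAs
    (Subsingleton ((Σ _ : {t : Fin i → G // t ∉ p i}, K ⟶ orbitE G) →₀ ℤ))

/-- The relative bar complex, with `ℤ[Hom(-, G/H)]` in degree zero. -/
def relResolutionComplex : ChainComplex (CoeffSystem G) ℕ :=
  ChainComplex.augment (ChainComplex.truncate.obj (relBar (faceClosed_tuplesIn H)))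
    (relBarAug H) (by
      change (relBar (faceClosed_tuplesIn H)).d 2 1 ≫ relBarAug H = 0
      rw [relBar_d]
      exact relBarD_comp_aug H)

theorem relResolutionComplex_d_one_zero : (relResolutionComplex H).d 1 0 = relBarAug H := rfl

theorem relResolutionComplex_d_succ (i : ℕ) :
    (relResolutionComplex H).d (i + 2) (i + 1) = relBarD (tuplesIn H) (i + 1) :=
  relBar_d (faceClosed_tuplesIn H) (i + 1)

theorem exact_of_subsingleton {A B C : Type} [Zero B] [Zero C] [Subsingleton B] {f : A → B}
    {g : B → C} (hg : g 0 = 0) [Nonempty A] : Function.Exact f g := fun y =>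
  ⟨fun _ => ⟨Classical.arbitrary A, Subsingleton.elim _ _⟩, fun _ => by
    rw [Subsingleton.elim y 0, hg]⟩

/-- If an orbit with nontrivial isotropy has at most one map to `G/H`, then the relative bar
complex is a projective resolution. -/
def relResolution (hH : ∀ K : OrbitCat G, IsEmpty (K ⟶ orbitE G) →
    Subsingleton (K ⟶ (⟨H⟩ : OrbitCat G))) : ProjectiveResolution (supportZ H) :=
  projectiveResolutionOfExact (relResolutionComplex H)
    (fun n => by
      cases n with
      | zero => exact (sumRep.repBasis _).projective
      | succ n => exact relBarX_projective (tuplesIn H) (n + 1))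
    (repHAug H) (repHAug_surjective H)
    (fun K => by
      rw [relResolutionComplex_d_one_zero]
      -- Away from the free orbit degree one vanishes, so exactness means injectivity of the
      -- augmentation, which is the hypothesis `hH`.
      by_cases hK : IsEmpty (K.unop ⟶ orbitE G)
      · have := hH _ hK
        have := relBarX_subsingleton (tuplesIn H) 1 hK
        intro z
        constructor
        · intro hz
          exact ⟨0, (map_zero ((relBarAug H).app K).hom).trans (repHAug_injective H
            (hz.trans (map_zero ((repHAug H).app K).hom).symm)).symm⟩
        · rintro ⟨y, rfl⟩
          exact congrArg (fun f => f.app K y) (relBarAug_comp_repHAug H)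
      · obtain ⟨φ⟩ := not_isEmpty_iff.mp hK
        obtain rfl : K = op (orbitE G) := congrArg op (sub_eq_bot_of_hom φ)
        exact repHAug_exact_orbitE H)
    (fun n K => by
      by_cases hK : IsEmpty (K.unop ⟶ orbitE G)
      · have : Subsingleton (((relResolutionComplex H).X (n + 1)).obj K) :=
          relBarX_subsingleton (tuplesIn H) (n + 1) hK
        exact exact_of_subsingleton (map_zero _)
      · obtain ⟨φ⟩ := not_isEmpty_iff.mp hK
        obtain rfl : K = op (orbitE G) := congrArg op (sub_eq_bot_of_hom φ)
        rw [relResolutionComplex_d_succ]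
        cases n with
        | zero => exact relBarAug_exact_orbitE H
        | succ n =>
          rw [relResolutionComplex_d_succ]
          exact relBarD_exact_orbitE H n)

end RelativeResolution

/-! ### Hom complexes and homotopy invariance -/

/-- A morphism of `ℤ`-modules given by an additive map. -/
def ModuleCat.homOfAddMonoidHom {A B : ModuleCat.{0} ℤ} (f : A →+ B) : A ⟶ B :=
  ModuleCat.ofHom
    { toFun := f
      map_add' := map_add f
      map_smul' := fun n x => by simpa using map_intCast_smul f ℤ ℤ n x }

section LinearYoneda

variable {C : Type*} [Category.{0} C] [Abelian C] [Linear ℤ C]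

/-- The map of cochain complexes `Hom(E, M) → Hom(D, M)` induced by a chain map `D → E`. -/
def linearYonedaMap {D E : ChainComplex C ℕ} (f : D ⟶ E) (M : C) :
    E.linearYonedaObj ℤ M ⟶ D.linearYonedaObj ℤ M where
  f i := ModuleCat.homOfAddMonoidHom (Preadditive.leftComp M (f.f i))
  comm' i j _ := by
    refine ConcreteCategory.hom_ext _ _ fun (η : E.X i ⟶ M) => ?_
    exact (f.comm_assoc j i η).symm

/-- Homotopy equivalent chain complexes have isomorphic cohomology groups with coefficients. -/
def linearYonedaHomologyIso {D E : ChainComplex C ℕ} (e : HomotopyEquiv D E) (M : C) (i : ℕ) :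
    (D.linearYonedaObj ℤ M).homology i ≅ (E.linearYonedaObj ℤ M).homology i :=
  HomologicalComplex.homologyUnop _ _ ≪≫
    ((((linearYoneda ℤ C).obj M).rightOp.mapHomotopyEquiv e).toHomologyIso i).symm.unop ≪≫
    (HomologicalComplex.homologyUnop _ _).symm

end LinearYoneda

/-! ### Relative cochains as the kernel of restriction -/

section LongExactSequence

variable {G : Type} [Group G] (H : Subgroup G) (M : CoeffSystem G)

/-- The empty tuple has all its entries in H. -/
theorem isZero_relBarX_zero : IsZero (relBarX (tuplesIn H) 0) := by
  refine (IsZero.iff_id_eq_zero _).mpr (relBarX_hom_ext fun t ht => ?_)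
  exact (ht fun k => k.elim0).elim

/-- The quotient map from the relative resolution to the relative bar complex. -/
def relResolutionToRelBar : relResolutionComplex H ⟶ relBar (faceClosed_tuplesIn H) where
  f
    | 0 => 0
    | i + 1 => 𝟙 ((relBar (faceClosed_tuplesIn H)).X (i + 1))
  comm' i j hij := by
    obtain rfl : j + 1 = i := hij
    cases j with
    | zero => exact (isZero_relBarX_zero H).eq_of_tgt _ _
    | succ j => exact (Category.id_comp _).trans (Category.comp_id _).symm

/-- The cochain complex computing the relative cohomology. -/
abbrev relCochains : CochainComplex (ModuleCat.{0} ℤ) ℕ :=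
  (relBar (faceClosed_tuplesIn H)).linearYonedaObj ℤ M

/-- The inclusion of the relative cochains into the inhomogeneous cochains. -/
def relCochainsIncl : relCochains H M ⟶ groupCohomology.inhomogeneousCochains M.atE where
  f i := ModuleCat.homOfAddMonoidHom (relBarEval (tuplesIn H) i M)
  comm' i j hij := by
    obtain rfl : i + 1 = j := hij
    rw [groupCohomology.inhomogeneousCochains.d_def]
    refine ConcreteCategory.hom_ext _ _ fun (η : relBarX (tuplesIn H) i ⟶ M) => ?_
    refine (relBarEval_comp_d (faceClosed_tuplesIn H) η).symm.trans ?_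
    change _ = relBarEval (tuplesIn H) (i + 1) M
      ((relBar (faceClosed_tuplesIn H)).d (i + 1) i ≫ η)
    rw [relBar_d]
    rfl

/-- The restriction of inhomogeneous cochains to a subgroup. -/
abbrev cochainsRes :
    groupCohomology.inhomogeneousCochains M.atE ⟶
      groupCohomology.inhomogeneousCochains (Rep.res H.subtype M.atE) :=
  groupCohomology.cochainsMap H.subtype (𝟙 _)

theorem relCochains_comp_res : relCochainsIncl H M ≫ cochainsRes H M = 0 := by
  refine HomologicalComplex.hom_ext _ _ fun i => ?_
  refine ConcreteCategory.hom_ext _ _ fun (η : relBarX (tuplesIn H) i ⟶ M) => ?_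
  refine funext fun t : Fin i → H => ?_
  change η.app _ (relBarMk (tuplesIn H) (𝟙 _) fun k => (t k : G)) = 0
  have ht : (fun k => (t k : G)) ∈ tuplesIn H i := fun k => (t k).2
  rw [relBarMk_of_mem _ _ ht, map_zero]

/-- A cochain restricting to zero on H is exactly one that descends to the relative bar complex, and
every cochain on H extends to G because H^i → G^i is injective. -/
theorem relCochains_shortExact :
    (ShortComplex.mk _ _ (relCochains_comp_res H M)).ShortExact := by
  refine HomologicalComplex.shortExact_of_degreewise_shortExact _ fun i => ?_
  refine { exact := ?_, mono_f := ?_, epi_g := ?_ }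
  · rw [ShortComplex.ShortExact.moduleCat_exact_iff_function_exact]
    intro f
    constructor
    · intro hf
      have hf' : ∀ t ∈ tuplesIn H i, (f : (Fin i → G) → M.atE) t = 0 := fun t ht =>
        congrFun hf fun k => ⟨t k, ht k⟩
      refine ⟨relBarDesc f, ?_⟩
      funext t
      refine (relBarDesc_mk _ _ hf' (𝟙 _) t).trans ?_
      rw [op_id, M.map_id]
      rfl
    · rintro ⟨η, rfl⟩
      exact congrArg (fun φ => (φ.f i).hom η) (relCochains_comp_res H M)
  · exact (ModuleCat.mono_iff_injective _).mpr (relBarEval_injective i M)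
  · exact groupCohomology.cochainsMap_f_map_epi _ _ H.subtype_injective i

end LongExactSequence

/-! ### Transport of exactness along isomorphisms -/

section ExactIso

variable {A B C D : ModuleCat.{0} ℤ}

theorem exact_inv_comp {f : A ⟶ B} {g : B ⟶ C} (e : A ≅ D) (h : Function.Exact f.hom g.hom) :
    Function.Exact (e.inv ≫ f).hom g.hom := fun y => by
  rw [h y]
  constructor
  · rintro ⟨x, rfl⟩
    exact ⟨e.hom x, congrArg f (e.hom_inv_id_apply x)⟩
  · rintro ⟨x, rfl⟩
    exact ⟨e.inv x, rfl⟩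

theorem exact_comp_hom {f : A ⟶ B} {g : B ⟶ C} (e : C ≅ D) (h : Function.Exact f.hom g.hom) :
    Function.Exact f.hom (g ≫ e.hom).hom := fun y => by
  rw [← h y]
  constructor
  · intro hy
    have := congrArg e.inv (show e.hom (g y) = 0 from hy)
    rwa [e.hom_inv_id_apply, map_zero] at this
  · intro hy
    exact (congrArg e.hom hy).trans (map_zero e.hom.hom)

theorem exact_comp_hom_inv_comp {f : A ⟶ B} {g : B ⟶ C} (e : B ≅ D)
    (h : Function.Exact f.hom g.hom) : Function.Exact (f ≫ e.hom).hom (e.inv ≫ g).hom := fun y => by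
  refine (h (e.inv y)).trans ⟨?_, ?_⟩
  · rintro ⟨x, hx⟩
    exact ⟨x, (congrArg e.hom hx).trans (e.inv_hom_id_apply y)⟩
  · rintro ⟨x, rfl⟩
    exact ⟨x, (e.hom_inv_id_apply (f x)).symm⟩

end ExactIso

/-! ### Cochain maps that are isomorphisms outside degree zero -/

section

variable {K L : CochainComplex (ModuleCat.{0} ℤ) ℕ} (f : K ⟶ L)
  (hf : ∀ i, i ≠ 0 → IsIso (f.f i))
include hf

/-- Cohomology in degree i + 2 involves only the degrees i + 1, i + 2 and i + 3, all nonzero. -/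
theorem isIso_homologyMap_of_isIso_f (i : ℕ) :
    IsIso (HomologicalComplex.homologyMap f (i + 2)) := by
  rw [← quasiIsoAt_iff_isIso_homologyMap,
    quasiIsoAt_iff' f (i + 1) (i + 2) (i + 3) (by simp) (by simp)]
  have : IsIso ((HomologicalComplex.shortComplexFunctor' _ _ (i + 1) (i + 2) (i + 3)).map f).τ₁ :=
    hf (i + 1) (by simp)
  have : IsIso ((HomologicalComplex.shortComplexFunctor' _ _ (i + 1) (i + 2) (i + 3)).map f).τ₂ :=
    hf (i + 2) (by simp)
  have : IsIso ((HomologicalComplex.shortComplexFunctor' _ _ (i + 1) (i + 2) (i + 3)).map f).τ₃ :=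
    hf (i + 3) (by simp)
  exact ShortComplex.quasiIso_of_epi_of_isIso_of_mono _

/-- Cocycles in degree 1 see only degrees 1 and 2, so they agree; the coboundaries come from degree
0 and may be larger in the target, whence only a surjection. -/
theorem epi_homologyMap_one_of_isIso_f : Epi (HomologicalComplex.homologyMap f 1) := by
  have : IsIso (HomologicalComplex.cyclesMap f 1) := by
    refine ShortComplex.isIso_cyclesMap_of_isIso_of_mono' _ (hf 1 (by simp)) ?_
    have : IsIso (f.f ((ComplexShape.up ℕ).next 1)) := hf _ (by simp)
    exact inferInstanceAs (Mono (f.f ((ComplexShape.up ℕ).next 1)))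
  have h := HomologicalComplex.homologyπ_naturality f 1
  have : Epi (HomologicalComplex.homologyπ K 1 ≫ HomologicalComplex.homologyMap f 1) := by
    rw [h]
    infer_instance
  exact epi_of_epi (HomologicalComplex.homologyπ K 1) _

end

/-! ### The long exact sequence for a resolution of `supportZ` -/

section LongExactSequence

variable {G : Type} [Group G] (H : Subgroup G) (M : CoeffSystem G)

theorem isIso_linearYonedaMap_f (i : ℕ) (hi : i ≠ 0) :
    IsIso ((linearYonedaMap (relResolutionToRelBar H) M).f i) := by
  obtain ⟨i, rfl⟩ := Nat.exists_eq_succ_of_ne_zero hi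
  have : (linearYonedaMap (relResolutionToRelBar H) M).f (i + 1) =
      𝟙 ((relCochains H M).X (i + 1)) := by
    refine ConcreteCategory.hom_ext _ _ fun (η : relBarX (tuplesIn H) (i + 1) ⟶ M) => ?_
    exact Category.id_comp η
  rw [Nat.succ_eq_add_one, this]
  exact inferInstanceAs (IsIso (𝟙 ((relCochains H M).X (i + 1))))

variable (hH : ∀ K : OrbitCat G, IsEmpty (K ⟶ orbitE G) → Subsingleton (K ⟶ (⟨H⟩ : OrbitCat G)))
  (P : ProjectiveResolution (supportZ H))

/-- The comparison of the cohomology of a resolution with the relative cohomology. -/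
def relCohomologyMap (i : ℕ) :
    (relCochains H M).homology i ⟶ (P.complex.linearYonedaObj ℤ M).homology i :=
  HomologicalComplex.homologyMap (linearYonedaMap (relResolutionToRelBar H) M) i ≫
    (linearYonedaHomologyIso (ProjectiveResolution.homotopyEquiv (relResolution H hH) P) M i).hom

theorem isIso_relCohomologyMap (i : ℕ) : IsIso (relCohomologyMap H M hH P (i + 2)) := by
  have := isIso_homologyMap_of_isIso_f _ (isIso_linearYonedaMap_f H M) i
  unfold relCohomologyMap
  exact @IsIso.comp_isIso _ _ _ _ _ _ _ this (Iso.isIso_hom _)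

theorem epi_relCohomologyMap_one : Epi (relCohomologyMap H M hH P 1) := by
  have := epi_homologyMap_one_of_isIso_f _ (isIso_linearYonedaMap_f H M)
  unfold relCohomologyMap
  exact @epi_comp _ _ _ _ _ _ this _ (@IsIso.epi_of_iso _ _ _ _ _ (Iso.isIso_hom _))

theorem relCochains_homology_zero : IsZero ((relCochains H M).homology 0) := by
  rw [← HomologicalComplex.exactAt_iff_isZero_homology, HomologicalComplex.exactAt_iff]
  refine ShortComplex.exact_of_isZero_X₂ _ ?_
  rw [IsZero.iff_id_eq_zero]
  refine ConcreteCategory.hom_ext _ _ fun (η : relBarX (tuplesIn H) 0 ⟶ M) => ?_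
  exact (isZero_relBarX_zero H).eq_of_src _ _

theorem exact_incl_res (i : ℕ) :
    Function.Exact (HomologicalComplex.homologyMap (relCochainsIncl H M) i).hom
      (groupCohomologyRes H M.atE i).hom :=
  (ShortComplex.ShortExact.moduleCat_exact_iff_function_exact _).mp
    ((relCochains_shortExact H M).homology_exact₂ i)

/-- The connecting homomorphism of relative cohomology. -/
def relδ (i : ℕ) : groupCohomology (Rep.res H.subtype M.atE) i ⟶
    (relCochains H M).homology (i + 1) :=
  (relCochains_shortExact H M).δ i (i + 1) rfl

theorem exact_res_relδ (i : ℕ) :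
    Function.Exact (groupCohomologyRes H M.atE i).hom (relδ H M i).hom :=
  (ShortComplex.ShortExact.moduleCat_exact_iff_function_exact _).mp
    ((relCochains_shortExact H M).homology_exact₃ i (i + 1) rfl)

theorem exact_relδ_incl (i : ℕ) :
    Function.Exact (relδ H M i).hom
      (HomologicalComplex.homologyMap (relCochainsIncl H M) (i + 1)).hom :=
  (ShortComplex.ShortExact.moduleCat_exact_iff_function_exact _).mp
    ((relCochains_shortExact H M).homology_exact₁ i (i + 1) rfl)

/-- There are no relative cochains in degree zero, so the kernel of restriction, an image of
relative cohomology, is zero. -/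
theorem res_zero_injective : Function.Injective (groupCohomologyRes H M.atE 0).hom := by
  rw [injective_iff_map_eq_zero]
  intro x hx
  obtain ⟨y, rfl⟩ := (exact_incl_res H M 0 x).mp hx
  have := (ModuleCat.isZero_iff_subsingleton).mp (relCochains_homology_zero H M)
  rw [Subsingleton.elim y 0]
  exact map_zero _

include hH in
/-- The long exact sequence for the cohomology of a projective resolution of `supportZ`. -/
theorem exists_long_exact_sequence :
    ∃ (α : ∀ i : ℕ, (P.complex.linearYonedaObj ℤ M).homology (i + 2) ⟶
          groupCohomology M.atE (i + 2))
      (δ : ∀ i : ℕ, groupCohomology (Rep.res H.subtype M.atE) (i + 1) ⟶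
          (P.complex.linearYonedaObj ℤ M).homology (i + 2))
      (A : ModuleCat.{0} ℤ) (δ₀ : groupCohomology (Rep.res H.subtype M.atE) 0 ⟶ A)
      (α₁ : A ⟶ groupCohomology M.atE 1) (q : A ⟶ (P.complex.linearYonedaObj ℤ M).homology 1),
      (∀ i : ℕ, Function.Exact (α i).hom (groupCohomologyRes H M.atE (i + 2)).hom) ∧
      (∀ i : ℕ, Function.Exact (groupCohomologyRes H M.atE (i + 2)).hom (δ (i + 1)).hom) ∧
      (∀ i : ℕ, Function.Exact (δ i).hom (α i).hom) ∧
      Function.Injective (groupCohomologyRes H M.atE 0).hom ∧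
      Function.Exact (groupCohomologyRes H M.atE 0).hom δ₀.hom ∧
      Function.Exact δ₀.hom α₁.hom ∧
      Function.Exact α₁.hom (groupCohomologyRes H M.atE 1).hom ∧
      Function.Exact (groupCohomologyRes H M.atE 1).hom (δ 0).hom ∧
      Function.Surjective q.hom := by
  have := isIso_relCohomologyMap H M hH P
  let e (i : ℕ) := asIso (relCohomologyMap H M hH P (i + 2))
  refine ⟨fun i => (e i).inv ≫ HomologicalComplex.homologyMap (relCochainsIncl H M) (i + 2),
    -- The group A is the relative cohomology in degree 1, where the comparison with the resolution
    -- is only surjective.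
    fun i => relδ H M (i + 1) ≫ (e i).hom, (relCochains H M).homology 1, relδ H M 0,
    HomologicalComplex.homologyMap (relCochainsIncl H M) 1, relCohomologyMap H M hH P 1,
    fun i => exact_inv_comp _ (exact_incl_res H M (i + 2)),
    fun i => exact_comp_hom _ (exact_res_relδ H M (i + 2)),
    fun i => exact_comp_hom_inv_comp _ (exact_relδ_incl H M (i + 1)),
    res_zero_injective H M, exact_res_relδ H M 0, exact_relδ_incl H M 0, exact_incl_res H M 1,
    exact_comp_hom _ (exact_res_relδ H M 1), ?_⟩
  exact (ModuleCat.epi_iff_surjective _).mp (epi_relCohomologyMap_one H M hH P)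

end LongExactSequence

/-! ### Vanishing of group cohomology by averaging -/

section Averaging

theorem Fin.contractNth_castSucc_snoc {α : Type} (op : α → α → α) {i : ℕ} (t : Fin (i + 1) → α)
    (x : α) {j : Fin (i + 1)} (hj : j ≠ Fin.last i) :
    Fin.contractNth j.castSucc op (Fin.snoc t x : Fin (i + 2) → α) =
      Fin.snoc (Fin.contractNth j op t) x := by
  have hj' : (j : ℕ) < i := Fin.val_lt_last hj
  funext k
  refine Fin.lastCases ?_ (fun k => ?_) k
  · have : ¬ i < (j : ℕ) := by omega
    have h' : i ≠ (j : ℕ) := by omega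
    simp [Fin.contractNth, this, h']
  · have : k.castSucc.succ = k.succ.castSucc := rfl
    simp only [Fin.contractNth, Fin.snoc_castSucc, Fin.val_castSucc, this]

theorem Fin.contractNth_castSucc_last_snoc {α : Type} (op : α → α → α) {i : ℕ}
    (t : Fin (i + 1) → α) (x : α) :
    Fin.contractNth (Fin.last i).castSucc op (Fin.snoc t x : Fin (i + 2) → α) =
      Fin.snoc (Fin.contractNth (Fin.last i) op t) (op (t (Fin.last i)) x) := by
  funext k
  refine Fin.lastCases ?_ (fun k => ?_) k
  · simp [Fin.contractNth]
  · simp [Fin.contractNth]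

theorem Fin.contractNth_last_snoc {α : Type} (op : α → α → α) {i : ℕ} (t : Fin i → α) (x : α) :
    Fin.contractNth (Fin.last i) op (Fin.snoc t x : Fin (i + 1) → α) = t := by
  funext k
  simp [Fin.contractNth]

variable {G : Type} [Group G] (V : Rep.{0} ℤ G)

theorem inhomogeneousCochains_d_apply {i : ℕ} (f : (Fin i → G) → V) (t : Fin (i + 1) → G) :
    (inhomogeneousCochains.d V i).hom f t = V.ρ (t 0) (f fun k => t k.succ) +
      ∑ j : Fin (i + 1), (((-1 : ℤ) ^ ((j : ℕ) + 1)) • f (Fin.contractNth j (· * ·) t) : V) := by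
  rw [inhomogeneousCochains.d_hom_apply]
  congr 1
  exact Finset.sum_congr rfl fun j _ => int_smul_eq_zsmul _ _ _

/-- Sum the cocycle identity for (t, x) over x. The faces not dropping x assemble to the
differential of the averaged cochain at t, and the last face contributes `f t` once for each x. -/
theorem d_sum_snoc [Fintype G] {i : ℕ} (f : (Fin (i + 1) → G) → V)
    (hf : (inhomogeneousCochains.d V (i + 1)).hom f = 0) (t : Fin (i + 1) → G) :
    (inhomogeneousCochains.d V i).hom (fun s => ∑ x, f (Fin.snoc s x)) t =
      (-1 : ℤ) ^ (i + 1) • (Fintype.card G) • f t := by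
  have h0 (x : G) : (Fin.snoc t x : Fin (i + 2) → G) 0 = t 0 := by
    rw [← Fin.castSucc_zero, Fin.snoc_castSucc]
  have h1 (x : G) : (fun k : Fin (i + 1) => (Fin.snoc t x : Fin (i + 2) → G) k.succ) =
      Fin.snoc (fun k : Fin i => t k.succ) x := by
    funext k
    refine Fin.lastCases ?_ (fun k => ?_) k
    · simp
    · rw [← Fin.castSucc_succ, Fin.snoc_castSucc, Fin.snoc_castSucc]
  have h2 (j : Fin (i + 1)) : ∑ x, f (Fin.contractNth j.castSucc (· * ·) (Fin.snoc t x)) =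
      ∑ x, f (Fin.snoc (Fin.contractNth j (· * ·) t) x) := by
    by_cases hj : j = Fin.last i
    · subst hj
      simp only [Fin.contractNth_castSucc_last_snoc]
      -- This face replaces x by its product with the last entry of t, which only permutes the
      -- summands.
      exact Fintype.sum_equiv (Equiv.mulLeft (t (Fin.last i))) _ _ fun x => rfl
    · simp only [Fin.contractNth_castSucc_snoc _ _ _ hj]
  have h (x : G) : V.ρ (t 0) (f (Fin.snoc (fun k => t k.succ) x)) +
      (∑ j : Fin (i + 1), (((-1 : ℤ) ^ ((j : ℕ) + 1)) •
        f (Fin.contractNth j.castSucc (· * ·) (Fin.snoc t x)) : V) +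
      ((-1 : ℤ) ^ (i + 2) • f t : V)) = 0 := by
    have := congrFun hf (Fin.snoc t x)
    rw [inhomogeneousCochains_d_apply, Fin.sum_univ_castSucc, Fin.contractNth_last_snoc, h0,
      h1] at this
    exact this
  have hs : ∑ x : G, V.ρ (t 0) (f (Fin.snoc (fun k => t k.succ) x)) +
      (∑ j : Fin (i + 1), (((-1 : ℤ) ^ ((j : ℕ) + 1)) •
        ∑ x : G, f (Fin.snoc (Fin.contractNth j (· * ·) t) x) : V) +
      ((-1 : ℤ) ^ (i + 2) • Fintype.card G • f t : V)) = 0 := by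
    have := Finset.sum_congr (rfl : (Finset.univ : Finset G) = _) fun x _ => h x
    rw [Finset.sum_add_distrib, Finset.sum_add_distrib, Finset.sum_comm, Finset.sum_const_zero,
      Finset.sum_const, Finset.card_univ] at this
    rw [← this]
    congr 2
    · refine Finset.sum_congr rfl fun j _ => ?_
      rw [← h2, Finset.sum_zsmul]
    · exact smul_comm _ _ _
  rw [inhomogeneousCochains_d_apply, map_sum]
  rw [← add_assoc] at hs
  refine (eq_neg_of_add_eq_zero_left hs).trans ?_
  rw [pow_succ _ (i + 1), mul_neg, mul_one, neg_zsmul, neg_neg]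

/-- The cohomology of a finite group vanishes in positive degrees if the order of the group acts
invertibly on the coefficients. -/
theorem groupCohomology_subsingleton_of_bijective [Fintype G]
    (hV : Function.Bijective fun v : V => Fintype.card G • v) (i : ℕ) :
    Subsingleton (groupCohomology V (i + 1)) := by
  refine ModuleCat.isZero_iff_subsingleton.mp ?_
  change IsZero ((groupCohomology.inhomogeneousCochains V).homology (i + 1))
  rw [← HomologicalComplex.exactAt_iff_isZero_homology,
    HomologicalComplex.exactAt_iff' _ i (i + 1) (i + 2) (by simp) (by simp),
    ShortComplex.ShortExact.moduleCat_exact_iff_function_exact]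
  intro f
  change (Fin (i + 1) → G) → V at f
  change ((groupCohomology.inhomogeneousCochains V).d (i + 1) (i + 2)).hom f = 0 ↔
    ∃ F, ((groupCohomology.inhomogeneousCochains V).d i (i + 1)).hom F = f
  rw [groupCohomology.inhomogeneousCochains.d_def, groupCohomology.inhomogeneousCochains.d_def]
  constructor
  · intro hf
    -- Surjectivity divides the signed average by |G|; injectivity then cancels |G| from the
    -- identity of `d_sum_snoc`.
    choose F hF using fun s : Fin i → G => hV.2 ((-1 : ℤ) ^ (i + 1) • ∑ x, f (Fin.snoc s x))
    refine ⟨F, funext fun t => hV.1 ?_⟩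
    have h := d_sum_snoc V f hf t
    have h' : Fintype.card G • F = (-1 : ℤ) ^ (i + 1) • fun s => ∑ x, f (Fin.snoc s x) :=
      funext hF
    have h'' := congrArg (fun F => (inhomogeneousCochains.d V i).hom F t) h'
    simp only [map_nsmul, map_zsmul, Pi.smul_apply, h] at h''
    refine h''.trans ?_
    rw [smul_smul, ← mul_pow]
    simp
  · rintro ⟨F, rfl⟩
    exact ConcreteCategory.congr_hom (groupCohomology.inhomogeneousCochains.d_comp_d i V) F

end Averaging

/-! ### Multiplication on m-profinite groups -/

section MProfinite

/-- Bézout for k and the power of m killing x gives an integer inverse to k on x. It depends on x,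
since no single power of m need kill the group. -/
theorem bijective_nsmul_of_torsion {A : Type} [AddCommGroup A] {m k : ℕ} (h : Nat.Coprime m k)
    (hA : ∀ x : A, ∃ j : ℕ, m ^ j • x = 0) : Function.Bijective fun x : A => k • x := by
  have key : ∀ x : A, ∃ u : ℤ, u • k • x = x := fun x => by
    obtain ⟨j, hj⟩ := hA x
    have hc : IsCoprime ((m ^ j : ℕ) : ℤ) (k : ℤ) :=
      Nat.isCoprime_iff_coprime.mpr (Nat.Coprime.pow_left j h)
    obtain ⟨a, b, hab⟩ := hc
    refine ⟨b, ?_⟩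
    have : (a * ((m ^ j : ℕ) : ℤ) + b * (k : ℤ)) • x = x := by rw [hab, one_zsmul]
    rwa [add_zsmul, mul_zsmul, mul_zsmul, natCast_zsmul, natCast_zsmul, hj, zsmul_zero,
      zero_add] at this
  constructor
  · refine (injective_iff_map_eq_zero (nsmulAddMonoidHom (α := A) k)).mpr fun x hx => ?_
    obtain ⟨u, hu⟩ := key x
    rw [← hu, show k • x = 0 from hx, zsmul_zero]
  · intro x
    obtain ⟨u, hu⟩ := key x
    exact ⟨u • x, (smul_comm k u x).trans hu⟩

/-- Multiplication by k is a natural automorphism of the torsion system, and the map it induces on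
the limit is again multiplication by k. -/
theorem IsMProfinite.bijective_nsmul {m k : ℕ} {B : Type} [AddCommGroup B]
    (hB : IsMProfinite m B) (h : Nat.Coprime m k) : Function.Bijective fun x : B => k • x := by
  obtain ⟨I, _, _, _, F, hF, ⟨e⟩⟩ := hB
  let μ : F ⟶ F :=
    { app := fun j => AddCommGrpCat.ofHom (nsmulAddMonoidHom k)
      naturality := fun i j f => by
        ext x
        exact (map_nsmul (F.map f).hom k x).symm }
  have : ∀ j, IsIso (μ.app j) := fun j =>
    (ConcreteCategory.isIso_iff_bijective _).mpr (bijective_nsmul_of_torsion h (hF j))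
  have : IsIso μ := NatIso.isIso_of_isIso_app μ
  have hl : Function.Bijective (limMap μ) :=
    (ConcreteCategory.isIso_iff_bijective _).mp inferInstance
  have hl' : ∀ x : ((limit F : AddCommGrpCat.{0}) : Type), limMap μ x = k • x := fun x => by
    refine Concrete.limit_ext _ _ _ fun j => ?_
    refine (ConcreteCategory.congr_hom (limMap_π μ j) x).trans ?_
    exact (map_nsmul (limit.π F j).hom k x).symm
  have he : Function.Bijective e.hom := (ConcreteCategory.isIso_iff_bijective _).mp inferInstance
  have : (fun x : B => k • x) = fun x => e.inv (limMap μ (e.hom x)) := funext fun x => by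
    rw [hl']
    exact ((map_nsmul e.inv.hom k _).trans (congrArg (k • ·) (e.hom_inv_id_apply x))).symm
  rw [this]
  exact ((ConcreteCategory.isIso_iff_bijective e.inv).mp inferInstance).comp (hl.comp he)

end MProfinite

/-! ### Fixed points of a set as a union of representables -/

section FixedPointPresheaf

variable {G : Type} [Group G] {Y : Type} [MulAction G Y]

/-- The orbit of a point of a `G`-set, with the stabilizer of a representative as isotropy. -/
def orbitOf (a : MulAction.orbitRel.Quotient G Y) : OrbitCat G :=
  ⟨MulAction.stabilizer G (Quotient.out a : Y)⟩

/-- The presheaf of fixed points of a `G`-set is the disjoint union of the presheaves represented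
by the orbits. -/
theorem sigma_orbit_bijective {S : OrbitCat G → Type} (act : ∀ {K L : OrbitCat G}, (K ⟶ L) →
      S L → S K) (u : ∀ K, S K → Y) (hu : ∀ K, Function.Injective (u K))
    (hfix : ∀ K s, ∀ k ∈ K.sub, k • u K s = u K s)
    (hact : ∀ {K L : OrbitCat G} (φ : K ⟶ L) (g : G), orbitHomElt φ = (g : G ⧸ L.sub) →
      ∀ s, u K (act φ s) = g • u L s)
    (y : ∀ a : MulAction.orbitRel.Quotient G Y, S (orbitOf a))
    (hy : ∀ a, u _ (y a) = Quotient.out a) (K : OrbitCat G) :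
    Function.Bijective fun x : Σ a : MulAction.orbitRel.Quotient G Y, K ⟶ orbitOf a =>
      act x.2 (y x.1) := by
  constructor
  · rintro ⟨a, φ⟩ ⟨b, ψ⟩ h
    obtain ⟨g, hg⟩ := QuotientGroup.mk_surjective (orbitHomElt φ)
    obtain ⟨g', hg'⟩ := QuotientGroup.mk_surjective (orbitHomElt ψ)
    have h' := congrArg (u K) h
    simp only at h'
    rw [hact φ g hg.symm, hact ψ g' hg'.symm, hy, hy] at h'
    have hab : a = b := by
      rw [← Quotient.out_eq a, ← Quotient.out_eq b]
      refine Quotient.sound ⟨g⁻¹ * g', ?_⟩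
      change (g⁻¹ * g') • (Quotient.out b : Y) = _
      rw [mul_smul, ← h', inv_smul_smul]
    subst hab
    congr 1
    refine orbitHomElt_injective ?_
    rw [← hg, ← hg', QuotientGroup.eq]
    change (g⁻¹ * g') • (Quotient.out a : Y) = _
    rw [mul_smul, ← h', inv_smul_smul]
  · intro s
    let a : MulAction.orbitRel.Quotient G Y := Quotient.mk'' (u K s)
    obtain ⟨g, hg⟩ : ∃ g : G, g • (Quotient.out a : Y) = u K s := by
      have h : MulAction.orbitRel G Y (Quotient.out a) (u K s) := Quotient.mk_out (u K s)
      obtain ⟨g, hg⟩ := h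
      exact ⟨g⁻¹, by rw [← hg]; exact inv_smul_smul g _⟩
    -- K fixes `s`, the g-translate of the chosen representative, so K fixes the coset of g modulo
    -- the stabilizer of that representative.
    have hq : ∀ k ∈ K.sub, k • (g : G ⧸ (orbitOf a).sub) = (g : G ⧸ (orbitOf a).sub) := by
      intro k hk
      rw [MulAction.Quotient.smul_coe, QuotientGroup.eq]
      change ((k • g)⁻¹ * g) • (Quotient.out a : Y) = _
      rw [mul_smul, hg, smul_eq_mul, inv_smul_eq_iff, mul_smul, hg, hfix K s k hk]
    refine ⟨⟨a, orbitHomMk (K := K) (L := orbitOf a) g hq⟩, hu K ?_⟩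
    simp only
    rw [hact _ g (orbitHomElt_mk _ _), hy, hg]

end FixedPointPresheaf

/-! ### The basis of simplices -/

section ChainBasis

open Simplicial

theorem linearCombination_single_one {A : ModuleCat.{0} ℤ} {ι : Type} (f : ι → A) (x : ι) :
    Finsupp.linearCombination ℤ f (Finsupp.single x 1) = f x :=
  (Finsupp.linearCombination_single ℤ _ _).trans (A.isModule.one_smul _)

/-- The chain given by a simplex. -/
def chainMk (T : SSet.{0}) {n : ℕ} (x : T _⦋n⦌) : (T.chainComplex (ModuleCat.of ℤ ℤ)).X n :=
  (T.ιChainComplex (R := ModuleCat.of ℤ ℤ) x).hom (1 : ℤ)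

theorem chainMap_chainMk {T T' : SSet.{0}} (f : T ⟶ T') {n : ℕ} (x : T _⦋n⦌) :
    (SSet.chainComplexMap f (ModuleCat.of ℤ ℤ)).f n (chainMk T x) = chainMk T' (f.app _ x) :=
  ConcreteCategory.congr_hom (SSet.ι_chainComplexMap_f T T' f (ModuleCat.of ℤ ℤ) x) (1 : ℤ)

/-- The chains as a module with basis the simplices. -/
def chainIso (T : SSet.{0}) (n : ℕ) :
    (T.chainComplex (ModuleCat.of ℤ ℤ)).X n ≅ ModuleCat.of ℤ (T _⦋n⦌ →₀ ℤ) where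
  hom := Sigma.desc fun x => ModuleCat.ofHom (Finsupp.lsingle x : ℤ →ₗ[ℤ] (T _⦋n⦌ →₀ ℤ))
  inv := ModuleCat.ofHom (Finsupp.linearCombination ℤ fun x => chainMk T x)
  hom_inv_id := by
    refine SSet.chainComplex_hom_ext fun x => ?_
    refine (Sigma.ι_desc_assoc (fun x =>
      ModuleCat.ofHom (Finsupp.lsingle x : ℤ →ₗ[ℤ] (T _⦋n⦌ →₀ ℤ))) x _).trans ?_
    refine ModuleCat.hom_ext (LinearMap.ext_ring ?_)
    exact linearCombination_single_one _ _
  inv_hom_id := by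
    refine ModuleCat.hom_ext (Finsupp.lhom_ext' fun x => LinearMap.ext_ring ?_)
    refine (congrArg (Sigma.desc fun x =>
      ModuleCat.ofHom (Finsupp.lsingle x : ℤ →ₗ[ℤ] (T _⦋n⦌ →₀ ℤ)))
      (linearCombination_single_one _ _)).trans ?_
    exact ConcreteCategory.congr_hom (Sigma.ι_desc (fun x =>
      ModuleCat.ofHom (Finsupp.lsingle x : ℤ →ₗ[ℤ] (T _⦋n⦌ →₀ ℤ))) x) (1 : ℤ)

/-- The basis of the simplicial chains given by the simplices. -/
def chainBasis (T : SSet.{0}) (n : ℕ) :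
    Module.Basis (T _⦋n⦌) ℤ ((T.chainComplex (ModuleCat.of ℤ ℤ)).X n) :=
  .ofRepr (chainIso T n).toLinearEquiv

theorem chainBasis_apply (T : SSet.{0}) (n : ℕ) (x : T _⦋n⦌) :
    chainBasis T n x = chainMk T x :=
  linearCombination_single_one _ _

theorem chainBasis_reindex_apply (T : SSet.{0}) (n : ℕ) {ι : Type} (e : ι ≃ T _⦋n⦌) (i : ι) :
    (chainBasis T n).reindex e.symm i = chainMk T (e i) := by
  rw [Module.Basis.reindex_apply, Equiv.symm_symm, chainBasis_apply]

end ChainBasis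

/-! ### Projectivity of the Bredon chains -/

section BredonProjective

open Simplicial

variable {G : Type} [Group G] (X : Type) [MulAction G X] [TopologicalSpace X]
  [ContinuousConstSMul G X]

/-- The singular simplices of the fixed points of a subgroup. -/
abbrev fixedSimplices (n : ℕ) (K : OrbitCat G) : Type :=
  (TopCat.toSSet.obj ((fixedPointsFunctor X).obj (op K))) _⦋n⦌

/-- The map of singular simplices induced by a morphism of orbits. -/
def fixedSimplicesMap (n : ℕ) {K L : OrbitCat G} (φ : K ⟶ L) :
    fixedSimplices X n L → fixedSimplices X n K :=
  (TopCat.toSSet.map ((fixedPointsFunctor X).map φ.op)).app (op ⦋n⦌)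

/-- A singular simplex of the fixed points as a singular simplex of the space. -/
def fixedSimplicesIncl (n : ℕ) (K : OrbitCat G) (s : fixedSimplices X n K) :
    C(SimplexCategory.toTop.{0}.obj ⦋n⦌, X) where
  toFun z := (s.down.hom z).1
  continuous_toFun := continuous_subtype_val.comp s.down.hom.continuous

theorem fixedSimplicesIncl_injective (n : ℕ) (K : OrbitCat G) :
    Function.Injective (fixedSimplicesIncl X n K) := fun s s' h => by
  refine ULift.ext _ _ (TopCat.hom_ext (ContinuousMap.ext fun z => Subtype.ext ?_))
  exact congrArg (fun f => f z) h

theorem fixedSimplicesIncl_map (n : ℕ) {K L : OrbitCat G} (φ : K ⟶ L) (g : G)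
    (hg : orbitHomElt φ = (g : G ⧸ L.sub)) (s : fixedSimplices X n L) :
    fixedSimplicesIncl X n K (fixedSimplicesMap X n φ s) = g • fixedSimplicesIncl X n L s := by
  refine ContinuousMap.ext fun z => ?_
  change orbitMap X (s.down.hom z) (orbitHomElt φ) = g • (s.down.hom z).1
  rw [hg]
  rfl

/-- A singular simplex with values in the fixed points. -/
def fixedSimplicesMk (n : ℕ) (K : OrbitCat G) (f : C(SimplexCategory.toTop.{0}.obj ⦋n⦌, X))
    (hf : ∀ k ∈ K.sub, k • f = f) : fixedSimplices X n K :=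
  ⟨TopCat.ofHom ⟨fun z => ⟨f z, fun k => congrArg (fun f => f z) (hf k k.2)⟩,
    f.continuous.subtype_mk _⟩⟩

/-- The presentation of the Bredon chains as a sum of representable systems. -/
def bredonChainsBasis (n : ℕ) : RepBasis ((bredonChains (G := G) X).X n)
    (orbitOf : MulAction.orbitRel.Quotient G C(SimplexCategory.toTop.{0}.obj ⦋n⦌, X) → _) :=
  let y (a : MulAction.orbitRel.Quotient G C(SimplexCategory.toTop.{0}.obj ⦋n⦌, X)) :
      fixedSimplices X n (orbitOf a) :=
    -- The universal element of an orbit of simplices is its representative, seen in the fixed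
    -- points of its own stabilizer.
    fixedSimplicesMk X n _ (Quotient.out a) fun _ hk => hk
  { p a := chainMk _ (y a)
    basis K := (chainBasis (TopCat.toSSet.obj ((fixedPointsFunctor X).obj (op K))) n).reindex
      (Equiv.ofBijective _ (sigma_orbit_bijective (fun φ => fixedSimplicesMap X n φ)
        (fixedSimplicesIncl X n) (fixedSimplicesIncl_injective X n)
        (fun K s k hk => ContinuousMap.ext fun z => (s.down.hom z).2 ⟨k, hk⟩)
        (fun φ g hg s => fixedSimplicesIncl_map X n φ g hg s) y (fun _ => rfl) K)).symm
    basis_apply K a φ := by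
      refine (chainBasis_reindex_apply _ _ _ _).trans ?_
      exact (chainMap_chainMk (TopCat.toSSet.map ((fixedPointsFunctor X).map φ.op)) (y a)).symm }

theorem bredonChains_projective (n : ℕ) : Projective ((bredonChains (G := G) X).X n) :=
  (bredonChainsBasis X n).projective

end BredonProjective

/-! ### Contractibility of fixed points of the infinite join -/

namespace InfiniteJoin

open unitInterval

variable {S : Type}

theorem exists_stage (x : InfiniteJoin S) : ∃ N, ∀ v, N ≤ v.1 → x.weight v = 0 := by
  refine ⟨x.weight.support.sup (fun v => v.1 + 1), fun v hv => ?_⟩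
  by_contra h
  have : v.1 + 1 ≤ _ := Finset.le_sup (f := fun v : ℕ × S => v.1 + 1)
    (Finsupp.mem_support_iff.mpr h)
  omega

theorem continuous_stage_incl (N : ℕ) : Continuous fun x : Stage S N => x.1 :=
  continuous_iSup_rng (i := N) continuous_coinduced_rng

theorem continuous_stage_weight (N : ℕ) (v : ℕ × S) :
    Continuous fun x : Stage S N => x.1.weight v :=
  (continuous_apply v).comp continuous_induced_dom

/-- A homotopy is continuous if it maps each stage to a stage, with continuous coordinates. -/
theorem continuous_of_stages (h : InfiniteJoin S → I → InfiniteJoin S) (b : ℕ → ℕ)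
    (hb : ∀ N x u, (∀ v, N ≤ v.1 → x.weight v = 0) → ∀ v, b N ≤ v.1 → (h x u).weight v = 0)
    (hc : ∀ N v, Continuous fun p : Stage S N × I => (h p.1.1 p.2).weight v) :
    Continuous fun p : InfiniteJoin S × I => h p.1 p.2 := by
  have hN : ∀ N, Continuous fun p : Stage S N × I => h p.1.1 p.2 := fun N => by
    let f : Stage S N × I → Stage S (b N) := fun p => ⟨h p.1.1 p.2, hb N _ _ p.1.2⟩
    have hf : Continuous f := continuous_induced_rng.mpr (continuous_pi fun v => hc N v)
    exact (continuous_stage_incl (b N)).comp hf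
  have hx : ∀ x, Continuous (h x) := fun x => by
    obtain ⟨N, hx⟩ := exists_stage x
    let y : Stage S N := ⟨x, hx⟩
    exact (hN N).comp (Continuous.prodMk_right y)
  -- Continuity out of a colimit is tested on stages, but the product with the interval is not
  -- presented as a colimit. Currying to the space of paths removes the product; local compactness
  -- of the interval allows uncurrying.
  let F : InfiniteJoin S → C(I, InfiniteJoin S) := fun x => ⟨h x, hx x⟩
  have hF : Continuous F := by
    refine continuous_iSup_dom.mpr fun N => continuous_coinduced_dom.mpr ?_
    exact ContinuousMap.continuous_of_continuous_uncurry _ (hN N)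
  exact ContinuousMap.continuous_uncurry_of_continuous ⟨F, hF⟩

/-- A function which increases from `0` to `1` on the interval `[1/(j+2), 1/(j+1)]`. -/
def ramp (j : ℕ) (u : ℝ) : ℝ := max 0 (min 1 ((j + 1) * (j + 2) * u - (j + 1)))

theorem continuous_ramp (j : ℕ) : Continuous (ramp j) := by
  unfold ramp
  fun_prop

theorem ramp_nonneg (j : ℕ) (u : ℝ) : 0 ≤ ramp j u := le_max_left _ _

theorem ramp_le_one (j : ℕ) (u : ℝ) : ramp j u ≤ 1 := max_le zero_le_one (min_le_left _ _)

theorem ramp_zero (j : ℕ) : ramp j 0 = 0 := by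
  refine max_eq_left (min_le_of_right_le ?_)
  have : (0 : ℝ) ≤ j := j.cast_nonneg
  linarith

theorem ramp_one (j : ℕ) : ramp j 1 = 1 := by
  have : (0 : ℝ) ≤ j := j.cast_nonneg
  unfold ramp
  rw [min_eq_left (by nlinarith), max_eq_right zero_le_one]

/-- `ramp j` starts at 1/(j+2), exactly where `ramp (j + 1)` reaches 1. So weight moves into copy j
+ 1 only after that copy's own weight has moved on, and a copy never carries two different points.
-/
theorem ramp_succ_eq_one {j : ℕ} {u : ℝ} (h : ramp j u ≠ 0) : ramp (j + 1) u = 1 := by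
  have hj : (0 : ℝ) ≤ j := j.cast_nonneg
  have h1 : 0 < (j + 1) * (j + 2) * u - ((j : ℝ) + 1) := by
    by_contra hc
    exact h (max_eq_left (min_le_of_right_le (not_lt.mp hc)))
  have h2 : 0 < ((j : ℝ) + 2) * u - 1 := by
    have : 0 < ((j : ℝ) + 1) * (((j : ℝ) + 2) * u - 1) := by linarith
    exact (pos_iff_pos_of_mul_pos this).mp (by linarith)
  unfold ramp
  rw [min_eq_left, max_eq_right zero_le_one]
  push_cast
  nlinarith

/-- The linear map which moves the proportion `ramp j u` of the weight in the `j`-th copy to the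
next copy. -/
def shiftWeight (u : ℝ) : (ℕ × S →₀ ℝ) →ₗ[ℝ] (ℕ × S →₀ ℝ) :=
  Finsupp.linearCombination ℝ fun v =>
    Finsupp.single v (1 - ramp v.1 u) + Finsupp.single (v.1 + 1, v.2) (ramp v.1 u)

theorem shiftWeight_zero_apply (u : ℝ) (w : ℕ × S →₀ ℝ) (s : S) :
    shiftWeight u w (0, s) = (1 - ramp 0 u) * w (0, s) := by
  induction w using Finsupp.induction_linear with
  | zero => simp
  | add f g hf hg => simp [hf, hg, mul_add]
  | single v r =>
    obtain ⟨j, t⟩ := v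
    classical
    simp only [shiftWeight, Finsupp.linearCombination_single, Finsupp.smul_apply,
      Finsupp.add_apply, Finsupp.single_apply, Prod.mk.injEq, smul_eq_mul]
    by_cases h : j = 0 ∧ t = s
    · obtain ⟨rfl, rfl⟩ := h
      simp [mul_comm]
    · simp [h]

theorem shiftWeight_succ_apply (u : ℝ) (w : ℕ × S →₀ ℝ) (i : ℕ) (s : S) :
    shiftWeight u w (i + 1, s) = (1 - ramp (i + 1) u) * w (i + 1, s) + ramp i u * w (i, s) := by
  induction w using Finsupp.induction_linear with
  | zero => simp
  | add f g hf hg => simp [hf, hg, mul_add]; ring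
  | single v r =>
    obtain ⟨j, t⟩ := v
    classical
    simp only [shiftWeight, Finsupp.linearCombination_single, Finsupp.smul_apply,
      Finsupp.add_apply, Finsupp.single_apply, Prod.mk.injEq, smul_eq_mul, add_left_inj]
    by_cases hs : t = s
    · subst hs
      by_cases h1 : j = i
      · subst h1
        simp [mul_comm]
      · by_cases h2 : j = i + 1
        · subst h2
          simp [mul_comm]
        · simp [h1, h2]
    · simp [hs]

theorem sum_shiftWeight (u : ℝ) (w : ℕ × S →₀ ℝ) :
    ((shiftWeight u w).sum fun _ r => r) = w.sum fun _ r => r := by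
  have h (w : ℕ × S →₀ ℝ) : (w.sum fun _ r => r) = Finsupp.linearCombination ℝ (fun _ => (1 : ℝ)) w := by
    simp [Finsupp.linearCombination_apply]
  rw [h, h]
  induction w using Finsupp.induction_linear with
  | zero => simp
  | add f g hf hg => simp only [map_add, hf, hg]
  | single v r =>
    simp only [shiftWeight, Finsupp.linearCombination_single, map_smul, map_add, smul_eq_mul]
    ring

/-- The homotopy from the identity to the shift of the infinite join. -/
def shift (x : InfiniteJoin S) (u : I) : InfiniteJoin S where
  weight := shiftWeight u x.weight
  nonneg := by
    rintro ⟨_ | j, s⟩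
    · rw [shiftWeight_zero_apply]
      exact mul_nonneg (sub_nonneg.mpr (ramp_le_one _ _)) (x.nonneg _)
    · rw [shiftWeight_succ_apply]
      exact add_nonneg (mul_nonneg (sub_nonneg.mpr (ramp_le_one _ _)) (x.nonneg _))
        (mul_nonneg (ramp_nonneg _ _) (x.nonneg _))
  unique := by
    rintro (_ | j) s t hs ht
    · rw [shiftWeight_zero_apply] at hs ht
      exact x.unique 0 s t (right_ne_zero_of_mul hs) (right_ne_zero_of_mul ht)
    · rw [shiftWeight_succ_apply] at hs ht
      by_cases h : ramp j u = 0
      · rw [h, zero_mul, add_zero] at hs ht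
        exact x.unique _ s t (right_ne_zero_of_mul hs) (right_ne_zero_of_mul ht)
      · rw [ramp_succ_eq_one h, sub_self, zero_mul, zero_add] at hs ht
        exact x.unique _ s t (right_ne_zero_of_mul hs) (right_ne_zero_of_mul ht)
  sum_eq_one := (sum_shiftWeight _ _).trans x.sum_eq_one

theorem continuous_shift : Continuous fun p : InfiniteJoin S × I => shift p.1 p.2 := by
  refine continuous_of_stages shift (fun N => N + 1) ?_ ?_
  · rintro N x u hx ⟨_ | j, s⟩ hv
    · exact absurd hv (by simp)
    · have hv' : N ≤ j := Nat.le_of_succ_le_succ hv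
      change shiftWeight _ _ _ = _
      rw [shiftWeight_succ_apply, hx (j + 1, s) (le_trans hv' j.le_succ), hx (j, s) hv']
      simp
  · rintro N ⟨_ | j, s⟩
    · simp only [shift, shiftWeight_zero_apply]
      exact (continuous_const.sub ((continuous_ramp 0).comp (continuous_subtype_val.comp
        continuous_snd))).mul ((continuous_stage_weight N _).comp continuous_fst)
    · simp only [shift, shiftWeight_succ_apply]
      exact ((continuous_const.sub ((continuous_ramp _).comp (continuous_subtype_val.comp
        continuous_snd))).mul ((continuous_stage_weight N _).comp continuous_fst)).add
        (((continuous_ramp _).comp (continuous_subtype_val.comp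
        continuous_snd)).mul ((continuous_stage_weight N _).comp continuous_fst))

theorem shift_zero (x : InfiniteJoin S) : shift x 0 = x := by
  ext ⟨_ | j, s⟩
  · simp [shift, shiftWeight_zero_apply, ramp_zero]
  · simp [shift, shiftWeight_succ_apply, ramp_zero]

/-- After the shift the first copy is free, so a cone vertex can be placed there. -/
theorem shift_one_weight_zero (x : InfiniteJoin S) (s : S) : (shift x 1).weight (0, s) = 0 := by
  simp [shift, shiftWeight_zero_apply, ramp_one]

/-- The weights of a point on the segment from `x` to a vertex of the first copy. -/
def coneWeight (s₀ : S) (x : InfiniteJoin S) (u : ℝ) : ℕ × S →₀ ℝ :=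
  (1 - u) • x.weight + Finsupp.single (0, s₀) u

theorem coneWeight_apply (s₀ : S) (x : InfiniteJoin S) (u : ℝ) (v : ℕ × S) :
    coneWeight s₀ x u v = (1 - u) * x.weight v + Finsupp.single (0, s₀) (1 : ℝ) v * u := by
  classical
  rw [coneWeight, Finsupp.add_apply, Finsupp.smul_apply, smul_eq_mul, Finsupp.single_apply,
    Finsupp.single_apply]
  split_ifs <;> simp

/-- The homotopy from the shift to the constant map at a vertex of the first copy. -/
def cone (s₀ : S) (x : InfiniteJoin S) (u : I) : InfiniteJoin S where
  weight := coneWeight s₀ (shift x 1) u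
  nonneg v := by
    classical
    rw [coneWeight_apply]
    refine add_nonneg (mul_nonneg (sub_nonneg.mpr u.2.2) ((shift x 1).nonneg v))
      (mul_nonneg ?_ u.2.1)
    rw [Finsupp.single_apply]
    split_ifs
    · exact zero_le_one
    · exact le_rfl
  unique := by
    classical
    rintro (_ | j) s t hs ht
    · have h : ∀ s, coneWeight s₀ (shift x 1) u (0, s) ≠ 0 → s₀ = s := fun s hs => by
        by_contra hne
        apply hs
        rw [coneWeight_apply, shift_one_weight_zero, Finsupp.single_apply,
          if_neg (by simpa using hne)]
        simp
      rw [← h s hs, ← h t ht]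
    · have h : ∀ s, coneWeight s₀ (shift x 1) u (j + 1, s) =
          (1 - (u : ℝ)) * (shift x 1).weight (j + 1, s) := fun s => by
        rw [coneWeight_apply, Finsupp.single_apply, if_neg (by simp), zero_mul, add_zero]
      rw [h] at hs ht
      exact (shift x 1).unique _ s t (right_ne_zero_of_mul hs) (right_ne_zero_of_mul ht)
  sum_eq_one := by
    classical
    rw [coneWeight, Finsupp.sum_add_index (by simp) (by simp), Finsupp.sum_smul_index (by simp),
      Finsupp.sum_single_index rfl, ← Finsupp.mul_sum, (shift x 1).sum_eq_one]
    ring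

theorem cone_weight (s₀ : S) (x : InfiniteJoin S) (u : I) (v : ℕ × S) :
    (cone s₀ x u).weight v =
      (1 - (u : ℝ)) * (shift x 1).weight v + (Finsupp.single (0, s₀) (1 : ℝ) v) * u :=
  coneWeight_apply _ _ _ _

theorem continuous_cone (s₀ : S) :
    Continuous fun p : InfiniteJoin S × I => cone s₀ p.1 p.2 := by
  classical
  refine continuous_of_stages (cone s₀) (fun N => N + 1) ?_ ?_
  · rintro N x u hx ⟨_ | j, s⟩ hv
    · exact absurd hv (by simp)
    · have hv' : N ≤ j := Nat.le_of_succ_le_succ hv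
      rw [cone_weight]
      have : (shift x 1).weight (j + 1, s) = 0 := by
        change shiftWeight _ _ _ = _
        rw [shiftWeight_succ_apply, hx (j + 1, s) (le_trans hv' j.le_succ), hx (j, s) hv']
        simp
      rw [this, Finsupp.single_apply, if_neg (by simp)]
      simp
  · intro N v
    simp only [cone_weight]
    have h1 : Continuous fun p : Stage S N × I => (shift p.1.1 1).weight v := by
      obtain ⟨_ | j, s⟩ := v
      · simp only [shift_one_weight_zero]
        exact continuous_const
      · simp only [shift, shiftWeight_succ_apply]
        exact (continuous_const.mul ((continuous_stage_weight N _).comp continuous_fst)).add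
          (continuous_const.mul ((continuous_stage_weight N _).comp continuous_fst))
    have h2 : Continuous fun p : Stage S N × I => (p.2 : ℝ) :=
      continuous_subtype_val.comp continuous_snd
    exact ((continuous_const.sub h2).mul h1).add (continuous_const.mul h2)

theorem cone_zero (s₀ : S) (x : InfiniteJoin S) : cone s₀ x 0 = shift x 1 := by
  ext v
  simp [cone_weight]

theorem cone_one (s₀ : S) (x y : InfiniteJoin S) : cone s₀ x 1 = cone s₀ y 1 := by
  ext v
  simp [cone_weight]

variable {G : Type} [Group G] [MulAction G S]

theorem smul_shift (g : G) (x : InfiniteJoin S) (u : I) : g • shift x u = shift (g • x) u := by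
  ext ⟨_ | j, s⟩
  · simp only [weight_smul, shift, shiftWeight_zero_apply]
  · simp only [weight_smul, shift, shiftWeight_succ_apply]

theorem smul_cone (g : G) {s₀ : S} (hs : g • s₀ = s₀) (x : InfiniteJoin S) (u : I) :
    g • cone s₀ x u = cone s₀ (g • x) u := by
  classical
  ext ⟨j, s⟩
  rw [weight_smul, cone_weight, cone_weight, ← smul_shift, weight_smul, Finsupp.single_apply,
    Finsupp.single_apply]
  have : s₀ = g⁻¹ • s ↔ s₀ = s := by rw [eq_inv_smul_iff, hs]
  simp only [Prod.mk.injEq, this]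

theorem exists_weight_eq_single (s₀ : S) : ∃ x : InfiniteJoin S, x.weight = Finsupp.single (0, s₀) 1 := by
  classical
  refine ⟨⟨Finsupp.single (0, s₀) 1, fun v => ?_, fun i s t hs ht => ?_, by simp⟩, rfl⟩
  · rw [Finsupp.single_apply]
    split_ifs <;> simp
  · rw [Finsupp.single_apply] at hs ht
    have h1 := (ite_ne_right_iff.mp hs).1
    have h2 := (ite_ne_right_iff.mp ht).1
    exact (Prod.ext_iff.mp h1).2.symm.trans (Prod.ext_iff.mp h2).2

/-- The fixed points of a subgroup on an infinite join are contractible if the subgroup has a fixed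
point on the set. -/
theorem contractibleSpace_fixedPoints (K : Subgroup G) {s₀ : S} (hs : ∀ k ∈ K, k • s₀ = s₀) :
    ContractibleSpace (MulAction.fixedPoints K (InfiniteJoin S)) := by
  obtain ⟨x₀, hx₀⟩ := exists_weight_eq_single s₀
  have hK : ∀ (x : MulAction.fixedPoints K (InfiniteJoin S)) (k : K),
      (k : G) • (x : InfiniteJoin S) = x := fun x k => x.2 k
  have hfix : x₀ ∈ MulAction.fixedPoints K (InfiniteJoin S) := fun k => by
    classical
    change (k : G) • x₀ = x₀
    ext ⟨j, s⟩
    rw [weight_smul, hx₀, Finsupp.single_apply, Finsupp.single_apply]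
    have : s₀ = (k : G)⁻¹ • s ↔ s₀ = s := by rw [eq_inv_smul_iff, hs k k.2]
    simp only [Prod.mk.injEq, this]
  let f : C(I × MulAction.fixedPoints K (InfiniteJoin S),
      MulAction.fixedPoints K (InfiniteJoin S)) :=
    { toFun := fun p => ⟨shift p.2 p.1, fun k => by
        change (k : G) • shift _ _ = _
        rw [smul_shift, hK]⟩
      continuous_toFun := Continuous.subtype_mk (continuous_shift.comp
        ((continuous_subtype_val.comp continuous_snd).prodMk continuous_fst)) _ }
  let c : C(I × MulAction.fixedPoints K (InfiniteJoin S),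
      MulAction.fixedPoints K (InfiniteJoin S)) :=
    { toFun := fun p => ⟨cone s₀ p.2 p.1, fun k => by
        change (k : G) • cone _ _ _ = _
        rw [smul_cone _ (hs k k.2), hK]⟩
      continuous_toFun := Continuous.subtype_mk ((continuous_cone s₀).comp
        ((continuous_subtype_val.comp continuous_snd).prodMk continuous_fst)) _ }
  let mid : C(MulAction.fixedPoints K (InfiniteJoin S), MulAction.fixedPoints K (InfiniteJoin S)) :=
    f.comp ((ContinuousMap.const _ 1).prodMk (ContinuousMap.id _))
  rw [contractible_iff_id_nullhomotopic]
  refine ⟨c (1, ⟨x₀, hfix⟩), ?_⟩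
  refine ContinuousMap.Homotopic.trans (g := mid) ⟨?_⟩ ⟨?_⟩
  · exact
      { toContinuousMap := f
        map_zero_left := fun x => Subtype.ext (shift_zero _)
        map_one_left := fun x => rfl }
  · exact
      { toContinuousMap := c
        map_zero_left := fun x => Subtype.ext (cone_zero s₀ _)
        map_one_left := fun x => Subtype.ext (cone_one s₀ _ _) }

end InfiniteJoin

/-! ### Singular chains of a contractible space -/

section ContractibleChains

open Simplicial AlgebraicTopology

variable (T : TopCat.{0})

/-- The singular chains of a space. -/
abbrev singularChains : ChainComplex (ModuleCat.{0} ℤ) ℕ :=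
  (TopCat.toSSet.obj T).chainComplex (ModuleCat.of ℤ ℤ)

/-- A point as a singular simplex. -/
def singularVertex (x : T) : (TopCat.toSSet.obj T) _⦋0⦌ :=
  ⟨TopCat.ofHom (ContinuousMap.const _ x)⟩

/-- A contraction of a space, as a homotopy of singular chain complexes. -/
theorem exists_homotopy_const [ContractibleSpace T] :
    ∃ x : T, Nonempty (Homotopy (𝟙 (singularChains T))
      (((singularChainComplexFunctor (ModuleCat.{0} ℤ)).obj (ModuleCat.of ℤ ℤ)).map
        (TopCat.ofHom (ContinuousMap.const T x)))) := by
  obtain ⟨x, ⟨h⟩⟩ := contractible_iff_id_nullhomotopic T |>.mp inferInstance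
  refine ⟨x, ⟨?_⟩⟩
  have H : TopCat.Homotopy (𝟙 T) (TopCat.ofHom (ContinuousMap.const T x)) := h
  exact (Homotopy.ofEq (CategoryTheory.Functor.map_id _ _).symm).trans
    (H.singularChainComplexFunctorObjMap (ModuleCat.of ℤ ℤ))

/-- The identity on homology equals the map induced by a constant map, which factors through the
vanishing positive homology of a point. -/
theorem singularChains_exact_succ [ContractibleSpace T] (n : ℕ) :
    Function.Exact ((singularChains T).d (n + 2) (n + 1)) ((singularChains T).d (n + 1) n) := by
  obtain ⟨x, ⟨h⟩⟩ := exists_homotopy_const T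
  have hz : IsZero ((singularChains T).homology (n + 1)) := by
    rw [IsZero.iff_id_eq_zero, ← HomologicalComplex.homologyMap_id]
    refine (h.homologyMap_eq _).trans ?_
    have hx : TopCat.ofHom (ContinuousMap.const T x) =
        TopCat.ofHom (ContinuousMap.const T PUnit.unit) ≫
          TopCat.ofHom (ContinuousMap.const PUnit x) := rfl
    refine (congrArg (fun f => HomologicalComplex.homologyMap f (n + 1))
      ((congrArg (((singularChainComplexFunctor _).obj _).map) hx).trans
        (CategoryTheory.Functor.map_comp _ _ _))).trans ?_
    refine (HomologicalComplex.homologyMap_comp _ _ _).trans ?_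
    have hp : IsZero ((singularChains (TopCat.of PUnit)).homology (n + 1)) :=
      (singularChainComplexFunctor_exactAt_of_totallyDisconnectedSpace _ (n + 1) _
        (TopCat.of PUnit) (by simp)).isZero_homology
    exact (congrArg _ (hp.eq_zero_of_src _)).trans comp_zero
  have hE : (singularChains T).ExactAt (n + 1) :=
    (HomologicalComplex.exactAt_iff_isZero_homology _ _).mpr hz
  rw [HomologicalComplex.exactAt_iff' _ (n + 2) (n + 1) n (by simp) (by simp)] at hE
  exact (ShortComplex.ShortExact.moduleCat_exact_iff_function_exact _).mp hE

theorem singularChains_d_chainMk (s : (TopCat.toSSet.obj T) _⦋1⦌) :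
    (singularChains T).d 1 0 (chainMk _ s) =
      chainMk _ ((TopCat.toSSet.obj T).δ 0 s) - chainMk _ ((TopCat.toSSet.obj T).δ 1 s) := by
  have h := ConcreteCategory.congr_hom
    ((TopCat.toSSet.obj T).ιChainComplex_d (R := ModuleCat.of ℤ ℤ) s) (1 : ℤ)
  refine h.trans ?_
  rw [Fin.sum_univ_two]
  simp only [Fin.val_zero, Fin.val_one, pow_zero, pow_one, one_smul, neg_smul, ← sub_eq_add_neg]
  rfl

/-- By the hypotheses the kernel of `ε` is the kernel of the coefficient sum `a`. The constant map
sends a 0-chain to its coefficient sum times a vertex, so it kills that kernel, and the homotopy to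
the identity exhibits each element as a boundary. -/
theorem singularChains_exact_zero [ContractibleSpace T] {A : ModuleCat.{0} ℤ}
    (ε : (singularChains T).X 0 ⟶ A) (hε : ∀ x y, ε (chainMk _ x) = ε (chainMk _ y))
    (hinj : ∀ x, Function.Injective (LinearMap.toSpanSingleton ℤ A (ε (chainMk _ x)))) :
    Function.Exact ((singularChains T).d 1 0) ε := by
  have hd : (singularChains T).d 1 0 ≫ ε = 0 := by
    refine ModuleCat.hom_ext ((chainBasis _ 1).ext fun s => ?_)
    rw [chainBasis_apply]
    refine (congrArg ε (singularChains_d_chainMk T s)).trans ?_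
    refine (map_sub ε.hom _ _).trans ?_
    exact sub_eq_zero.mpr (hε _ _)
  obtain ⟨x, ⟨h⟩⟩ := exists_homotopy_const T
  let c := TopCat.ofHom (ContinuousMap.const T x)
  intro z
  constructor
  · intro hz
    let s₀ := singularVertex T x
    let a : (singularChains T).X 0 →ₗ[ℤ] ℤ :=
      (chainBasis (TopCat.toSSet.obj T) 0).constr ℤ fun _ => (1 : ℤ)
    have ha : ∀ s, a (chainMk _ s) = 1 := fun s => by
      rw [← chainBasis_apply]
      exact Module.Basis.constr_basis _ _ _ _
    have h1 : ε.hom = (LinearMap.toSpanSingleton ℤ A (ε (chainMk _ s₀))).comp a := by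
      refine (chainBasis _ 0).ext fun s => ?_
      rw [chainBasis_apply, LinearMap.comp_apply, ha]
      exact (hε _ _).trans (A.isModule.one_smul _).symm
    have h2 : (((SSet.chainComplexMap (TopCat.toSSet.map c) (ModuleCat.of ℤ ℤ))).f 0).hom =
        (LinearMap.toSpanSingleton ℤ _ (chainMk _ s₀)).comp a := by
      refine (chainBasis _ 0).ext fun s => ?_
      rw [chainBasis_apply, LinearMap.comp_apply, ha]
      refine (chainMap_chainMk _ _).trans (Eq.trans ?_ (ModuleCat.isModule _ |>.one_smul _).symm)
      rfl
    have hz' : a z = 0 := (map_eq_zero_iff _ (hinj s₀)).mp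
      ((LinearMap.congr_fun h1 z).symm.trans hz)
    have h3 : (SSet.chainComplexMap (TopCat.toSSet.map c) (ModuleCat.of ℤ ℤ)).f 0 z = 0 := by
      refine (LinearMap.congr_fun h2 z).trans ?_
      rw [LinearMap.comp_apply, hz', map_zero]
    have h0 := h.comm 0
    rw [Homotopy.dNext_zero_chainComplex, zero_add, Homotopy.prevD_chainComplex] at h0
    have h4 := ConcreteCategory.congr_hom h0 z
    refine ⟨h.hom 0 1 z, ?_⟩
    refine Eq.trans ?_ h4.symm
    exact ((congrArg (_ + ·) h3).trans (add_zero _)).symm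
  · rintro ⟨y, rfl⟩
    exact ConcreteCategory.congr_hom hd y

end ContractibleChains

/-! ### The Bredon chains as a resolution of `supportZ` -/

section BredonResolution

open Simplicial

variable {G : Type} [Group G] (H : Subgroup G)

/-- Pick a coset `s` of nonzero weight in a fixed point. Its translate by k in K has the same weight
in the same copy, so it equals `s`; a coset fixed by K is a map of orbits to G/H. -/
theorem InfiniteJoin.nonempty_hom_of_fixedPoints {K : OrbitCat G}
    (x : MulAction.fixedPoints K.sub (InfiniteJoin (G ⧸ H))) :
    Nonempty (K ⟶ (⟨H⟩ : OrbitCat G)) := by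
  obtain ⟨⟨i, s⟩, hs⟩ : ∃ v, x.1.weight v ≠ 0 := by
    by_contra! h
    have h0 : x.1.weight = 0 := Finsupp.ext h
    have h1 := x.1.sum_eq_one
    rw [h0] at h1
    exact zero_ne_one h1
  refine ⟨orbitHomMk (L := ⟨H⟩) s fun k hk => ?_⟩
  refine x.1.unique i _ _ ?_ hs
  have hx : k • x.1 = x.1 := x.2 ⟨k, hk⟩
  rw [← hx, weight_smul, inv_smul_smul]
  exact hs

theorem nonempty_hom_of_fixedSimplices {n : ℕ} {K : OrbitCat G}
    (s : fixedSimplices (InfiniteJoin (G ⧸ H)) n K) : Nonempty (K ⟶ (⟨H⟩ : OrbitCat G)) :=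
  InfiniteJoin.nonempty_hom_of_fixedPoints H 
    (s.down.hom (Classical.arbitrary (SimplexCategory.toTop.{0}.obj ⦋n⦌)))

/-- The value of the augmentation of the Bredon chains of an infinite join. -/
def bredonAugApp (K : OrbitCat G) :
    (singularChains ((fixedPointsFunctor (InfiniteJoin (G ⧸ H))).obj (op K))).X 0 ⟶
      (supportZ H).obj (op K) :=
  ModuleCat.ofHom ((Finsupp.linearCombination ℤ fun s =>
    supportZ.one H (nonempty_hom_of_fixedSimplices H (K := K) s)).comp
      (chainBasis _ 0).repr.toLinearMap)

theorem bredonAugApp_chainMk (K : OrbitCat G)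
    (s : fixedSimplices (InfiniteJoin (G ⧸ H)) 0 K) :
    bredonAugApp H K (chainMk _ s) = supportZ.one H (nonempty_hom_of_fixedSimplices H s) := by
  rw [← chainBasis_apply]
  refine (congrArg (Finsupp.linearCombination ℤ _) (Module.Basis.repr_self _ _)).trans ?_
  exact linearCombination_single_one _ _

/-- The augmentation of the Bredon chains of an infinite join. -/
def bredonAug : (bredonChains (G := G) (InfiniteJoin (G ⧸ H))).X 0 ⟶ supportZ H where
  app K := bredonAugApp H K.unop
  naturality K L φ := by
    refine ModuleCat.hom_ext ((chainBasis (TopCat.toSSet.obj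
      ((fixedPointsFunctor (InfiniteJoin (G ⧸ H))).obj K)) 0).ext fun s => ?_)
    rw [chainBasis_apply]
    refine (congrArg (bredonAugApp H L.unop) (chainMap_chainMk (TopCat.toSSet.map
      ((fixedPointsFunctor (InfiniteJoin (G ⧸ H))).map φ)) s)).trans ?_
    refine (bredonAugApp_chainMk H _ _).trans ?_
    refine Eq.trans ?_ (congrArg ((supportZ H).map φ) (bredonAugApp_chainMk H _ s)).symm
    exact (supportZ.map_one H φ.unop _ _).symm

theorem contractibleSpace_of_hom {K : OrbitCat G} (φ : K ⟶ (⟨H⟩ : OrbitCat G)) :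
    ContractibleSpace ((fixedPointsFunctor (InfiniteJoin (G ⧸ H))).obj (op K)) :=
  InfiniteJoin.contractibleSpace_fixedPoints K.sub (s₀ := orbitHomElt φ)
    fun k hk => orbitHomElt_smul_eq φ ⟨k, hk⟩

theorem subsingleton_chains {K : OrbitCat G} (hK : IsEmpty (K ⟶ (⟨H⟩ : OrbitCat G))) (n : ℕ) :
    Subsingleton (((bredonChains (InfiniteJoin (G ⧸ H))).X n).obj (op K)) := by
  have : IsEmpty (fixedSimplices (InfiniteJoin (G ⧸ H)) n K) :=
    ⟨fun s => (nonempty_hom_of_fixedSimplices H s).elim hK.false⟩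
  exact (chainBasis (TopCat.toSSet.obj ((fixedPointsFunctor
    (InfiniteJoin (G ⧸ H))).obj (op K))) n).repr.injective.subsingleton

theorem subsingleton_supportZ {K : OrbitCat G} (hK : IsEmpty (K ⟶ (⟨H⟩ : OrbitCat G))) :
    Subsingleton ((supportZ H).obj (op K)) := by
  have : IsEmpty (PLift (Nonempty (K ⟶ (⟨H⟩ : OrbitCat G)))) := ⟨fun h => h.down.elim hK.false⟩
  exact inferInstanceAs (Subsingleton (PLift (Nonempty (K ⟶ (⟨H⟩ : OrbitCat G))) →₀ ℤ))

theorem supportZ.injective_toSpanSingleton {K : OrbitCat G}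
    (h : Nonempty (K ⟶ (⟨H⟩ : OrbitCat G))) :
    Function.Injective (LinearMap.toSpanSingleton ℤ ((supportZ H).obj (op K))
      (supportZ.one H h)) := by
  refine Function.LeftInverse.injective
    (g := fun f : PLift (Nonempty (K ⟶ (⟨H⟩ : OrbitCat G))) →₀ ℤ => f ⟨h⟩) fun k => ?_
  change (k • (Finsupp.single (PLift.up h) (1 : ℤ))) (PLift.up h) = k
  simp

theorem supportZ.surjective_toSpanSingleton {K : OrbitCat G}
    (h : Nonempty (K ⟶ (⟨H⟩ : OrbitCat G))) :
    Function.Surjective (LinearMap.toSpanSingleton ℤ ((supportZ H).obj (op K))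
      (supportZ.one H h)) := by
  intro f
  let f' : PLift (Nonempty (K ⟶ (⟨H⟩ : OrbitCat G))) →₀ ℤ := f
  refine ⟨f' ⟨h⟩, ?_⟩
  change (f' ⟨h⟩ • (Finsupp.single (PLift.up h) (1 : ℤ))) = f'
  ext x
  simp

/-- The Bredon chains of the infinite join of `G/H` resolve the coefficient system `supportZ`. -/
def bredonResolution : ProjectiveResolution (supportZ H) :=
  projectiveResolutionOfExact (bredonChains (G := G) (InfiniteJoin (G ⧸ H)))
    (bredonChains_projective _) (bredonAug H)
    (fun K => by
      induction K using Opposite.rec with | op K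
      by_cases hK : IsEmpty (K ⟶ (⟨H⟩ : OrbitCat G))
      · have := subsingleton_supportZ H hK
        exact fun z => ⟨0, Subsingleton.elim _ _⟩
      · have hK' := not_isEmpty_iff.mp hK
        intro z
        obtain ⟨k, rfl⟩ := supportZ.surjective_toSpanSingleton H hK' z
        have := contractibleSpace_of_hom H hK'.some
        let x : (fixedPointsFunctor (InfiniteJoin (G ⧸ H))).obj (op K) := Classical.arbitrary _
        refine ⟨LinearMap.toSpanSingleton ℤ (singularChains _ |>.X 0)
          (chainMk _ (singularVertex _ x)) k, ?_⟩
        refine ((bredonAugApp H K).hom.map_smul k _).trans ?_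
        exact congrArg (fun y => LinearMap.toSpanSingleton ℤ _ y k) (bredonAugApp_chainMk H K _))
    (fun K => by
      induction K using Opposite.rec with | op K
      by_cases hK : IsEmpty (K ⟶ (⟨H⟩ : OrbitCat G))
      · have := subsingleton_chains H hK 0
        have := subsingleton_supportZ H hK
        exact fun z => ⟨fun _ => ⟨0, Subsingleton.elim _ _⟩, fun _ => Subsingleton.elim _ _⟩
      · have hK' := not_isEmpty_iff.mp hK
        have := contractibleSpace_of_hom H hK'.some
        refine singularChains_exact_zero _ (bredonAugApp H K) (fun s t => ?_) fun s => ?_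
        · rw [bredonAugApp_chainMk, bredonAugApp_chainMk]
        · rw [bredonAugApp_chainMk]
          exact supportZ.injective_toSpanSingleton H _)
    (fun n K => by
      induction K using Opposite.rec with | op K
      by_cases hK : IsEmpty (K ⟶ (⟨H⟩ : OrbitCat G))
      · have := subsingleton_chains H hK (n + 1)
        have := subsingleton_chains H hK n
        exact fun z => ⟨fun _ => ⟨0, Subsingleton.elim _ _⟩, fun _ => Subsingleton.elim _ _⟩
      · have := contractibleSpace_of_hom H (not_isEmpty_iff.mp hK).some
        exact singularChains_exact_succ _ n)

end BredonResolution

/-! ### Reflections in dihedral groups of odd degree -/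

section Dihedral

variable {n : ℕ}

theorem mem_reflectionSubgroup_iff {g : DihedralGroup n} :
    g ∈ reflectionSubgroup n ↔ g = 1 ∨ g = DihedralGroup.sr 0 := by
  unfold reflectionSubgroup
  constructor
  · intro h
    have h2 : (DihedralGroup.sr 0 : DihedralGroup n) ^ 2 = 1 := by
      rw [pow_two, DihedralGroup.sr_mul_self]
    obtain ⟨k, rfl⟩ := Subgroup.mem_zpowers_iff.mp h
    rcases Int.even_or_odd' k with ⟨l, rfl | rfl⟩
    · left
      rw [zpow_mul]
      norm_cast
      rw [h2, one_zpow]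
    · right
      rw [zpow_add, zpow_mul, zpow_one]
      norm_cast
      rw [h2, one_zpow, one_mul]
  · rintro (rfl | rfl)
    · exact one_mem _
    · exact Subgroup.mem_zpowers _

/-- The subgroup `H` is its own centralizer. -/
theorem mem_reflectionSubgroup_of_commute (hn : Odd n) {g : DihedralGroup n}
    (h : g * DihedralGroup.sr 0 = DihedralGroup.sr 0 * g) : g ∈ reflectionSubgroup n := by
  -- Oddness of n enters here: 2 is a unit modulo n.
  have key : ∀ i : ZMod n, i + i = 0 → i = 0 := fun i hi => by
    have h2 : IsUnit ((2 : ℕ) : ZMod n) :=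
      (ZMod.isUnit_iff_coprime 2 n).mpr (Nat.coprime_two_left.mpr hn)
    refine h2.mul_right_eq_zero.mp ?_
    rw [Nat.cast_ofNat, two_mul, hi]
  rw [mem_reflectionSubgroup_iff]
  cases g with
  | r i =>
    rw [DihedralGroup.r_mul_sr, DihedralGroup.sr_mul_r, DihedralGroup.sr.injEq] at h
    left
    rw [key i (by linear_combination -h)]
    rfl
  | sr i =>
    rw [DihedralGroup.sr_mul_sr, DihedralGroup.sr_mul_sr, DihedralGroup.r.injEq] at h
    right
    rw [key i (by linear_combination -h)]

/-- A nontrivial subgroup of the dihedral group fixes at most one reflection coset. -/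
theorem subsingleton_hom_reflectionSubgroup (hn : Odd n) (K : OrbitCat (DihedralGroup n))
    (hK : IsEmpty (K ⟶ orbitE (DihedralGroup n))) :
    Subsingleton (K ⟶ (⟨reflectionSubgroup n⟩ : OrbitCat (DihedralGroup n))) := by
  obtain ⟨k, hk, hk1⟩ : ∃ k ∈ K.sub, k ≠ 1 := by
    by_contra! h
    refine hK.false (orbitHomMk ((1 : DihedralGroup n) : DihedralGroup n ⧸ ⊥) fun k hk => ?_)
    rw [h k hk, one_smul]
  refine ⟨fun φ ψ => orbitHomElt_injective ?_⟩
  -- If k ≠ 1 fixes gH, then g⁻¹kg is the nontrivial element of H. For two such cosets gH and g'H,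
  -- the element g⁻¹g' then commutes with the reflection, hence lies in H.
  have conj : ∀ g : DihedralGroup n,
      k • (g : DihedralGroup n ⧸ reflectionSubgroup n) = g → k * g = g * DihedralGroup.sr 0 := by
    intro g hg
    rw [MulAction.Quotient.smul_coe, smul_eq_mul, eq_comm, QuotientGroup.eq,
      mem_reflectionSubgroup_iff] at hg
    rcases hg with hg | hg
    · refine absurd ?_ hk1
      exact mul_eq_right.mp (inv_mul_eq_one.mp hg).symm
    · exact inv_mul_eq_iff_eq_mul.mp hg
  obtain ⟨g, hg⟩ := QuotientGroup.mk_surjective (orbitHomElt φ)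
  obtain ⟨g', hg'⟩ := QuotientGroup.mk_surjective (orbitHomElt ψ)
  have h1 := conj g (by rw [hg]; exact orbitHomElt_smul_eq φ ⟨k, hk⟩)
  have h2 := conj g' (by rw [hg']; exact orbitHomElt_smul_eq ψ ⟨k, hk⟩)
  rw [← hg, ← hg', QuotientGroup.eq]
  refine mem_reflectionSubgroup_of_commute hn ?_
  have h3 : k = g * DihedralGroup.sr 0 * g⁻¹ := eq_mul_inv_of_mul_eq h1
  rw [mul_assoc, ← h2, h3]
  group

end Dihedral

end

/-! ### The main theorem -/

theorem mainTheorem6 (n : ℕ) (hn : Odd n) (M : CoeffSystem (DihedralGroup n)) :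
    (∃ (α : ∀ i : ℕ, bredonCohomology (EHD n) M (i + 2) ⟶ groupCohomology M.atE (i + 2))
        (δ : ∀ i : ℕ,
          groupCohomology (Rep.res (reflectionSubgroup n).subtype M.atE) (i + 1) ⟶
            bredonCohomology (EHD n) M (i + 2))
        (A : ModuleCat.{0} ℤ)
        (δ₀ : groupCohomology (Rep.res (reflectionSubgroup n).subtype M.atE) 0 ⟶ A)
        (α₁ : A ⟶ groupCohomology M.atE 1)
        (q : A ⟶ bredonCohomology (EHD n) M 1),
        -- the long exact sequence in degrees at least two
        (∀ i : ℕ, Function.Exact (α i).hom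
          (groupCohomologyRes (reflectionSubgroup n) M.atE (i + 2)).hom) ∧
        (∀ i : ℕ, Function.Exact
          (groupCohomologyRes (reflectionSubgroup n) M.atE (i + 2)).hom (δ (i + 1)).hom) ∧
        (∀ i : ℕ, Function.Exact (δ i).hom (α i).hom) ∧
        -- its extension to low degrees
        Function.Injective (groupCohomologyRes (reflectionSubgroup n) M.atE 0).hom ∧
        Function.Exact (groupCohomologyRes (reflectionSubgroup n) M.atE 0).hom δ₀.hom ∧
        Function.Exact δ₀.hom α₁.hom ∧
        Function.Exact α₁.hom (groupCohomologyRes (reflectionSubgroup n) M.atE 1).hom ∧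
        Function.Exact (groupCohomologyRes (reflectionSubgroup n) M.atE 1).hom (δ 0).hom ∧
        Function.Surjective q.hom) ∧
    (∀ m : ℕ, Nat.Coprime m (2 * n) → IsMProfinite m M.atE →
      ∀ i : ℕ, 1 < i → Subsingleton (bredonCohomology (EHD n) M i)) := by
  have hseq := exists_long_exact_sequence (reflectionSubgroup n) M
    (subsingleton_hom_reflectionSubgroup hn) (bredonResolution (reflectionSubgroup n))
  refine ⟨hseq, fun m hm hM i hi => ?_⟩
  obtain ⟨α, δ, -, -, -, -, -, -, hex, -⟩ := hseq
  obtain ⟨i, rfl⟩ := Nat.exists_eq_add_of_lt hi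
  rw [show 1 + i + 1 = i + 2 by ring]
  have : NeZero n := ⟨hn.pos.ne'⟩
  have : Fintype (reflectionSubgroup n) := Fintype.ofFinite _
  have hG : Subsingleton (groupCohomology M.atE (i + 2)) :=
    groupCohomology_subsingleton_of_bijective M.atE
      (hM.bijective_nsmul (by rwa [DihedralGroup.card])) (i + 1)
  have hH : Subsingleton
      (groupCohomology (Rep.res (reflectionSubgroup n).subtype M.atE) (i + 1)) :=
    groupCohomology_subsingleton_of_bijective
      (Rep.res (reflectionSubgroup n).subtype M.atE) (hM.bijective_nsmul (hm.coprime_dvd_right (by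
        rw [← DihedralGroup.nat_card, ← Nat.card_eq_fintype_card]
        exact Subgroup.card_subgroup_dvd_card _))) i
  refine subsingleton_of_forall_eq 0 fun z => ?_
  -- The Bredon group lies between the cohomology of H in degree i + 1 and that of D_n in degree i +
  -- 2, both zero.
  obtain ⟨y, rfl⟩ := (hex i z).mp (hG.elim _ _)
  rw [hH.elim y 0, map_zero]
  rfl
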